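/- \textbf{The model.} Let $0<\alpha\le 1$, $0\le\gamma\le 1$ and $D\in\{3,4,\dots\}\cup\{\infty\}$, with $\gamma<1$ if $D=\infty$. Put $\eta=-\frac{1-\alpha}{D-2}$ if $D<\infty$ and $\eta=1-\gamma$ if $D=\infty$. Trees are planar, rooted and locally finite, with a root of degree one; the size of a finite tree is its number of edges and its height $h(T)$ is the maximal distance of a vertex from the root. Edges adjacent to a vertex of degree one other than the root are called leaves, all other edges inner edges. The attachment and grafting model is the following growth process. Start from the unique tree with two edges and in each step select, with the given relative probabilities, (a) a vertex of degree $k\ge 2$, with relative probability $\eta k+1-2\eta-\alpha$, and attach a new edge to it, at one of the $k$ possible positions chosen uniformly; or (b) an inner edge, with relative probability $\alpha$, and divide it into two edges by a new vertex; or (c) a leaf, with relative probability $1-\eta$, and divide it into two edges by a new vertex. Let $\nu_n$ be the law of the resulting tree with $n$ edges ($n\ge2$), and let $\nu_1$ be concentrated on the single edge. For $n,R\ge 0$ let $$C_{n,R}=\frac{-\eta\,\Gamma(n-\eta)}{\Gamma(1-\eta)\,\Gamma(n+1)}\,\nu_n(\{h(T)\le R\}),\qquad H_R(\zeta)=\sum_{n=0}^\infty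 C_{n,R}\,\zeta^n ,$$ with the convention $\nu_0(\{h(T)\le R\})=1$, where the quotient of Gamma functions is read as $\frac{(-\eta)(1-\eta)\cdots(n-1-\eta)}{n!}$ (its continuous extension) if $\eta\in\{0,1\}$. \textbf{Proposition.} The measures $\nu_n$ are probability measures and converge weakly, in the topology of local convergence, to a probability measure $\nu$ on the set of planar rooted locally finite trees, and $\nu$-almost every tree has a unique infinite non-backtracking path $s_0,s_1,s_2,\dots$ (the spine) starting at the root $s_0$. For $i\ge1$ let the outgrowth $\mathcal A^i$ be the union of $s_i$ and the trees attached to it off the spine, and let $X^i_n$ be the number of vertices of $\mathcal A^i$ at distance $n$ from $s_i$. Then for all integers $R\ge0$ the series $H_R(\zeta)$ converges for $0\le\zeta<1$, the function $H_R^{(\alpha-1)/\eta}$ is integrable on $(0,1)$, and for all $i\ge1$ the probability that $\mathcal A^i$ is extinct at level $R+1$ is $$\nu(\{X^i_{R+1}=0\})=\alpha\int_0^1 H_R(\zeta)^{\frac{\alpha-1}{\eta}}\,d\zeta .$$ (If $\eta=0$, which under these assumptions means $\alpha=1$ and $D<\infty$, then $H_R\equiv1$ and the integrand is read as $1$.)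 -/

import Mathlib

open MeasureTheory Filter Topology

noncomputable section

namespace AG

/-! ### Finite planar rooted trees with root of valency one -/

/-- A finite planar rooted tree whose root has valency one. `node [T₁, …, T_{k-1}]` is the tree in
which the unique neighbour `v` of the root has degree `k`, and `T₁, …, T_{k-1}` are, in planar
order, the subtrees (again with a root of valency one) planted at `v`. The tree `node []` is the
single edge. -/
inductive FTree : Type
  | node : List FTree → FTree

namespace FTree

/-- The subtrees planted at the neighbour of the root. -/
def subtrees : FTree → List FTree
  | node l => l

/-- The tree consisting of a single edge. -/
def edge : FTree := node []

mutual
/-- The height of a finite tree: the maximal graph distance of a vertex from the root. -/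
def height : FTree → ℕ
  | node l => heightList l + 1
/-- The maximum of the heights in a list of trees (`0` for the empty list). -/
def heightList : List FTree → ℕ
  | [] => 0
  | t :: ts => max (height t) (heightList ts)
end

mutual
/-- All possible growth moves of the attachment and grafting model on a tree, each with its
relative weight and the resulting tree. With `v` the neighbour of the root, of degree `k`:
* the root edge is divided in two by grafting a vertex, with weight `1 - η` if it is a leaf
  (that is, `k = 1`) and weight `a` if it is an inner edge;
* if `k ≥ 2`, a new edge is attached to `v`, the total weight `η k + 1 - 2 η - a` being divided
  equally among the `k` possible positions;
* a move is performed at an edge or vertex of one of the subtrees planted at `v`. -/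
def moves (a η : ℝ) : FTree → List (ℝ × FTree)
  | node l =>
      (if l.isEmpty then 1 - η else a, node [node l]) ::
        ((if l.isEmpty then [] else
            (List.range (l.length + 1)).map fun j =>
              ((η * ((l.length : ℝ) + 1) + 1 - 2 * η - a) / ((l.length : ℝ) + 1),
                node (l.insertIdx j edge)))
          ++ (movesList a η l).map fun p => (p.1, node p.2))
/-- The growth moves inside one of the trees of a list. -/
def movesList (a η : ℝ) : List FTree → List (ℝ × List FTree)
  | [] => []
  | t :: ts =>
      ((moves a η t).map fun p => (p.1, p.2 :: ts))
        ++ (movesList a η ts).map fun p => (p.1, t :: p.2)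
end

open Classical in
/-- The probability `ℙ(T' → T)` of growing `T` from `T'` in one step: the total weight of the moves
leading from `T'` to `T`, divided by the total weight of all moves. -/
def growProb (a η : ℝ) (T' T : FTree) : ℝ :=
  ((moves a η T').map fun p => if p.2 = T then p.1 else 0).sum
    / ((moves a η T').map fun p => p.1).sum

/-- The number of children of the vertex with address `u`, where addresses are relative to the
neighbour of the root (whose address is `[]`); it is `0` if there is no vertex with address `u`. -/
def childCount : List ℕ → FTree → ℕ
  | [], T => T.subtrees.length
  | j :: u, T =>
      match T.subtrees[j]? with
      | some S => childCount u S
      | none => 0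

end FTree

/-! ### Locally finite planar rooted trees -/

/-- The set of planar, rooted, locally finite trees (finite or infinite) whose root has valency
one. Vertices are addressed by finite sequences of natural numbers: `[]` is the root and
`u ++ [0], u ++ [1], …, u ++ [τ u - 1]` are the children of the vertex `u` in planar order. A tree
is encoded by the function giving the number of children at each address, which is `0` at every
address that is not a vertex. It carries the subspace topology and σ-algebra of the product
`List ℕ → ℕ` with `ℕ` discrete; this is the topology of local convergence (convergence of all balls
around the root) with its Borel σ-algebra. -/
abbrev PlanarTree : Type :=
  {c : List ℕ → ℕ // c [] = 1 ∧ ∀ (u : List ℕ) (j : ℕ), c u ≤ j → c (u ++ [j]) = 0}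

/-- The child counts of a finite tree, with addresses relative to the root. -/
def FTree.rootedCount (T : FTree) : List ℕ → ℕ
  | [] => 1
  | 0 :: u => T.childCount u
  | (_ + 1) :: _ => 0

theorem FTree.childCount_append (u : List ℕ) (j : ℕ) :
    ∀ T : FTree, T.childCount u ≤ j → T.childCount (u ++ [j]) = 0 := by
  induction u with
  | nil =>
    intro T h
    simp only [FTree.childCount] at h
    simp [FTree.childCount, List.getElem?_eq_none h]
  | cons i u ih =>
    intro T h
    simp only [FTree.childCount, List.cons_append] at h ⊢
    cases hS : T.subtrees[i]? with
    | none => rfl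
    | some S =>
      rw [hS] at h
      exact ih S h

/-- A finite tree as a locally finite tree. -/
def FTree.toPlanarTree (T : FTree) : PlanarTree :=
  ⟨T.rootedCount, rfl, by
    intro u j h
    match u, j, h with
    | [], 0, h => simp [FTree.rootedCount] at h
    | [], j + 1, _ => rfl
    | 0 :: u, j, h => exact FTree.childCount_append u j T h
    | (_ + 1) :: _, _, _ => rfl⟩

namespace PlanarTree

/-- `u` is the address of a vertex of `τ`: the root is a vertex, and `w ++ [j]` is one if and only
if `w` is and has more than `j` children. -/
inductive IsVertex (τ : PlanarTree) : List ℕ → Prop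
  | root : IsVertex τ []
  | child {w : List ℕ} {j : ℕ} : IsVertex τ w → j < τ.1 w → IsVertex τ (w ++ [j])

/-- `s` is an infinite non-backtracking path in `τ` started at the root: `s 0` is the root, and
`s (n + 1)` is a child of `s n`. -/
def IsSpine (τ : PlanarTree) (s : ℕ → List ℕ) : Prop :=
  s 0 = [] ∧ ∀ n, ∃ j < τ.1 (s n), s (n + 1) = s n ++ [j]

/-- For a tree `τ` with spine `s`, the vertices at distance `n` from `s i` in the outgrowth of the
spine at `s i`. The outgrowth consists of `s i` together with those of its descendants that are not
`s (i + 1)` or descendants of it; the distance of a descendant of `s i` to `s i` is the difference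
of the lengths of the addresses. -/
def outgrowthLevel (τ : PlanarTree) (s : ℕ → List ℕ) (i n : ℕ) : Set (List ℕ) :=
  {u | IsVertex τ u ∧ s i <+: u ∧ ¬ s (i + 1) <+: u ∧ u.length = (s i).length + n}

/-- The size `X^i_n` of the `n`-th generation of the outgrowth at `s i`. -/
def outgrowthSize (τ : PlanarTree) (s : ℕ → List ℕ) (i n : ℕ) : ℕ :=
  (outgrowthLevel τ s i n).ncard

end PlanarTree

/-! ### The attachment and grafting model -/

/-- The parameter `η` of the model with parameters `a`, `g` and maximal degree `D`. -/
def eta (a g : ℝ) (D : ℕ∞) : ℝ :=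
  if D = ⊤ then 1 - g else -((1 - a) / ((D.toNat : ℝ) - 2))

open Classical in
/-- The probability `ν_n(T)` that the growth process, when it has `n` edges, equals `T`. The process
starts from the unique tree with two edges; `ν_1` is concentrated on the single edge. There is no
tree with `0` edges, and the value at `n = 0` is the zero function. -/
def nu (a g : ℝ) (D : ℕ∞) : ℕ → FTree → ℝ
  | 0, _ => 0
  | 1, T => if T = FTree.edge then 1 else 0
  | 2, T => if T = FTree.node [FTree.edge] then 1 else 0
  | n + 3, T => ∑' T' : FTree, nu a g D (n + 2) T' * FTree.growProb a (eta a g D) T' T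

/-- The finite volume measure `ν_n` on the space of planar trees. -/
def nuMeasure (a g : ℝ) (D : ℕ∞) (n : ℕ) : Measure PlanarTree :=
  Measure.sum fun T : FTree => ENNReal.ofReal (nu a g D n T) • Measure.dirac T.toPlanarTree

/-- The probability `ν_n(h(T) ≤ R)`, with the convention that it is `1` for `n = 0`. -/
def nuHeight (a g : ℝ) (D : ℕ∞) (n R : ℕ) : ℝ :=
  if n = 0 then 1 else ∑' T : FTree, if T.height ≤ R then nu a g D n T else 0

/-- The factor `-η Γ(n - η) / (Γ(1 - η) Γ(n + 1))`, written as
`(-η)(1 - η)(2 - η) ⋯ (n - 1 - η) / n!`. This is the same number for `η < 1`, `η ≠ 0`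
(see `gammaFactor_eq`), and its continuous extension at the values `η = 0` and `η = 1`, where a
pole of the Gamma function occurs. -/
def gammaFactor (η : ℝ) (n : ℕ) : ℝ :=
  (ascPochhammer ℝ n).eval (-η) / (n.factorial : ℝ)

theorem gammaFactor_eq (η : ℝ) (h0 : η ≠ 0) (h1 : η < 1) (n : ℕ) :
    gammaFactor η n
      = -η * Real.Gamma (n - η) / (Real.Gamma (1 - η) * Real.Gamma (n + 1)) := by
  have hG : Real.Gamma (1 - η) ≠ 0 := (Real.Gamma_pos_of_pos (by linarith)).ne'
  have key : ∀ n : ℕ,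
      (ascPochhammer ℝ n).eval (-η) * Real.Gamma (1 - η) = -η * Real.Gamma (n - η) := by
    intro n
    induction n with
    | zero =>
      have := Real.Gamma_add_one (s := -η) (neg_ne_zero.mpr h0)
      rw [show (1 : ℝ) - η = -η + 1 by ring, this]
      simp
    | succ n ih =>
      have hn : (n : ℝ) - η ≠ 0 := by
        rcases Nat.eq_zero_or_pos n with rfl | hpos
        · simpa using h0
        · have : (1 : ℝ) ≤ n := by exact_mod_cast hpos
          intro h
          linarith
      have := Real.Gamma_add_one hn
      rw [ascPochhammer_succ_eval]
      push_cast
      rw [show (n : ℝ) + 1 - η = n - η + 1 by ring, this]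
      linear_combination ((n : ℝ) - η) * ih
  rw [gammaFactor, Real.Gamma_nat_eq_factorial, ← key n]
  have hf : (n.factorial : ℝ) ≠ 0 := by exact_mod_cast n.factorial_ne_zero
  field_simp

/-- The coefficient `C_{n,R}`. -/
def coeffC (a g : ℝ) (D : ℕ∞) (n R : ℕ) : ℝ :=
  gammaFactor (eta a g D) n * nuHeight a g D n R

/-- The generating function `H_R(ζ) = ∑_{n ≥ 0} C_{n,R} ζ^n`. -/
def genH (a g : ℝ) (D : ℕ∞) (R : ℕ) (ζ : ℝ) : ℝ :=
  ∑' n : ℕ, coeffC a g D n R * ζ ^ n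

end AG

end

-- The whole argument rests on one fact: the total weight of all moves on a tree with `n` edges is
-- `n - η`, whatever its shape (`lsum_moves_one`). Applied to the subtrees planted at the neighbour
-- `v` of the root, it shows that their sizes form a Markov chain. Given the sizes, the subtrees are
-- independent and each follows the same growth law (`Admissible.expect_eq_expectList`).
--
-- The size chain satisfies a linear recursion (`Admissible.sizeProb_succ`). Fix all sizes but one,
-- with sum `M`, and let the remaining size `m` tend to infinity. The recursion becomes `(m + M + 1
-- - η) y (m+1) = (m - η) y m + b m`, where `b` converges by induction on `M`, so `y` tends to `lim
-- b / (M + 1)` (`tendsto_of_recursion`). This gives the explicit limit `limProb`: `a / (M + 1)`,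
-- times a product of attachment weights, times a factor `splitCoeff η k` for each finite subtree of
-- size `k`.
--
-- Writing `1 / (M + 1)` as the integral of `ζ ^ M` over the unit interval turns sums over
-- outgrowths into integrals of generating functions. If the planted trees are restricted to a set
-- `S` with weighted generating function `G`, summing over the number of trees is a binomial series
-- and yields `a ∫ (1 - η G) ^ ((a - 1) / η)` (`Admissible.tsum_outgrowthProb`). For `S` the trees
-- of height at most `R`, `1 - η G` is exactly `H_R`. For `S` all trees it is `(1 - ζ) ^ η`, and the
-- integral equals one, so `outgrowthProb` is a probability law and no mass is lost in the limit.
--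
-- The limit tree is therefore built from i.i.d. outgrowths along a spine (`Admissible.limitLaw`).
-- The spine is unique because a path leaving it enters a finite tree (`eq_spine`). Convergence
-- follows from the portmanteau theorem: an open set is exhausted by events fixing finitely many
-- outgrowths, and their limiting probabilities bound the liminf from below
-- (`Admissible.limitLaw_le_of_isOpen`). Extinction at level `R + 1` means that every tree of the
-- outgrowth has height at most `R`, which gives the formula.

noncomputable section

namespace AG

/-! ### Finite weighted sums -/

/-- The integral of `F` against the finite weighted sum of point masses described by `d`. -/
def lsum {β : Type*} (d : List (ℝ × β)) (F : β → ℝ) : ℝ := (d.map fun p => p.1 * F p.2).sum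

section lsum
variable {β κ : Type*}

@[simp] theorem lsum_nil (F : β → ℝ) : lsum [] F = 0 := rfl

@[simp] theorem lsum_cons (p : ℝ × β) (d : List (ℝ × β)) (F : β → ℝ) :
    lsum (p :: d) F = p.1 * F p.2 + lsum d F := by simp [lsum]

@[simp] theorem lsum_append (d e : List (ℝ × β)) (F : β → ℝ) :
    lsum (d ++ e) F = lsum d F + lsum e F := by simp [lsum]

theorem lsum_map (d : List (ℝ × β)) (f : β → κ) (F : κ → ℝ) :
    lsum (d.map fun p => (p.1, f p.2)) F = lsum d fun x => F (f x) := by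
  simp [lsum, Function.comp_def]

theorem lsum_add (d : List (ℝ × β)) (F G : β → ℝ) :
    lsum d (fun x => F x + G x) = lsum d F + lsum d G := by
  induction d with
  | nil => simp
  | cons p d ih => simp only [lsum_cons, ih]; ring

theorem lsum_const_mul (d : List (ℝ × β)) (c : ℝ) (F : β → ℝ) :
    lsum d (fun x => c * F x) = c * lsum d F := by
  induction d with
  | nil => simp
  | cons p d ih => simp only [lsum_cons, ih]; ring

theorem lsum_mul_const (d : List (ℝ × β)) (c : ℝ) (F : β → ℝ) :
    lsum d (fun x => F x * c) = lsum d F * c := by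
  simp only [mul_comm _ c, lsum_const_mul]

theorem lsum_congr {d : List (ℝ × β)} {F G : β → ℝ} (h : ∀ p ∈ d, F p.2 = G p.2) :
    lsum d F = lsum d G := by
  unfold lsum
  congr 1
  exact List.map_congr_left fun p hp => by rw [h p hp]

/-- One step of a Markov chain with kernel `k`, whose normalising constant `c` does not depend on
the current state. -/
theorem lsum_flatMap (d : List (ℝ × β)) (k : β → List (ℝ × κ)) (c : ℝ) (F : κ → ℝ) :
    lsum (d.flatMap fun p => (k p.2).map fun q => (p.1 * q.1 / c, q.2)) F
      = lsum d (fun x => lsum (k x) F) / c := by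
  induction d with
  | nil => simp
  | cons p d ih =>
    have : lsum ((k p.2).map fun q => (p.1 * q.1 / c, q.2)) F = p.1 * lsum (k p.2) F / c := by
      induction k p.2 with
      | nil => simp
      | cons q e ih => simp only [List.map_cons, lsum_cons, ih]; ring
    simp only [List.flatMap_cons, lsum_append, ih, this, lsum_cons]
    ring

theorem lsum_finset_sum {ι : Type*} (s : Finset ι) (d : List (ℝ × β)) (F : ι → β → ℝ) :
    lsum d (fun x => ∑ i ∈ s, F i x) = ∑ i ∈ s, lsum d (F i) := by
  classical
  induction s using Finset.induction_on with
  | empty => simp [lsum]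
  | insert i s hi ih => simp only [Finset.sum_insert hi, lsum_add, ih]

theorem lsum_mono {d : List (ℝ × β)} {F G : β → ℝ}
    (h : ∀ p ∈ d, 0 ≤ p.1 ∧ F p.2 ≤ G p.2) : lsum d F ≤ lsum d G := by
  induction d with
  | nil => simp
  | cons p d ih =>
    simp only [lsum_cons]
    have h1 := h p (by simp)
    exact add_le_add (mul_le_mul_of_nonneg_left h1.2 h1.1)
      (ih fun q hq => h q (by simp [hq]))

-- The bridge between series over all trees, used to define `nu`, and the finite sums in which the
-- proof computes.
open Classical in
theorem hasSum_lsum (d : List (ℝ × β)) (F : β → ℝ) :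
    HasSum (fun x => lsum d (fun y => if y = x then 1 else 0) * F x) (lsum d F) := by
  induction d with
  | nil => simp [hasSum_zero]
  | cons p d ih =>
    simp only [lsum_cons, add_mul]
    refine HasSum.add ?_ ih
    convert hasSum_single p.2 ?_ using 1
    · simp
    · intro x hx
      simp [Ne.symm hx]

end lsum

/-- The sum of the values of `Ψ` at all lists obtained by inserting `x` into a given list. -/
def insSum {β : Type*} (x : β) : (List β → ℝ) → List β → ℝ
  | Ψ, [] => Ψ [x]
  | Ψ, y :: ys => Ψ (x :: y :: ys) + insSum x (fun l => Ψ (y :: l)) ys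

/-- Replaces insertion indices by a structural recursion, so that later identities follow by
induction on the list. -/
theorem sum_insertIdx {β : Type*} (x : β) (Ψ : List β → ℝ) (l : List β) :
    ((List.range (l.length + 1)).map fun j => Ψ (l.insertIdx j x)).sum = insSum x Ψ l := by
  induction l generalizing Ψ with
  | nil => simp [insSum]
  | cons y ys ih =>
    rw [List.length_cons, List.range_succ_eq_map]
    simp only [List.map_cons, List.map_map, List.sum_cons, insSum]
    rw [← ih]
    simp [Function.comp_def]

-- Sizes of trees and total weights of growth moves

namespace FTree

theorem node_subtrees (T : FTree) : node T.subtrees = T := by cases T; rfl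

theorem induction_subtrees {P : FTree → Prop} (h : ∀ l, (∀ t ∈ l, P t) → P (node l)) :
    ∀ T, P T :=
  FTree.rec (motive_1 := P) (motive_2 := fun l => ∀ t ∈ l, P t) (fun l hl => h l hl)
    (by simp) (fun t ts ht hts => by simpa using ⟨ht, hts⟩)

mutual
/-- The number of edges of a finite tree. -/
def size : FTree → ℕ
  | node l => sizeList l + 1
/-- The total number of edges of the trees in a list. -/
def sizeList : List FTree → ℕ
  | [] => 0
  | t :: ts => size t + sizeList ts
end

theorem sizeList_eq (l : List FTree) : sizeList l = (l.map size).sum := by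
  induction l with
  | nil => simp [sizeList]
  | cons t ts ih => simp [sizeList, ih]

theorem size_node (l : List FTree) : size (node l) = (l.map size).sum + 1 := by
  rw [size, sizeList_eq]

@[simp] theorem size_edge : size edge = 1 := by simp [edge, size_node]

theorem size_pos (T : FTree) : 0 < size T := by cases T; simp [size]

/-- The weight with which a new edge is attached, at each of the `r + 1` possible positions, to a
vertex with `r` children. -/
def attachWeight (a η : ℝ) (r : ℕ) : ℝ :=
  (η * ((r : ℝ) + 1) + 1 - 2 * η - a) / ((r : ℝ) + 1)

theorem lsum_moves_edge (a η : ℝ) (F : FTree → ℝ) :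
    lsum (moves a η edge) F = (1 - η) * F (node [edge]) := by
  simp [edge, moves, movesList]

theorem lsum_moves_node (a η : ℝ) (F : FTree → ℝ) {l : List FTree} (hl : l ≠ []) :
    lsum (moves a η (node l)) F = a * F (node [node l])
      + attachWeight a η l.length * insSum edge (fun l => F (node l)) l
      + lsum (movesList a η l) fun l => F (node l) := by
  have h : l.isEmpty = false := by simpa using hl
  rw [moves, h, ← sum_insertIdx]
  simp only [Bool.false_eq_true, if_false, lsum_cons, lsum_append, lsum_map, ← add_assoc]
  congr 2
  simp only [lsum, List.map_map, Function.comp_def, attachWeight]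
  rw [List.sum_map_mul_left]

theorem lsum_movesList_nil (a η : ℝ) (Ψ : List FTree → ℝ) : lsum (movesList a η []) Ψ = 0 := by
  simp [movesList]

theorem lsum_movesList_cons (a η : ℝ) (Ψ : List FTree → ℝ) (t : FTree) (ts : List FTree) :
    lsum (movesList a η (t :: ts)) Ψ = lsum (moves a η t) (fun t' => Ψ (t' :: ts))
      + lsum (movesList a η ts) (fun ts' => Ψ (t :: ts')) := by
  rw [movesList, lsum_append, lsum_map _ (fun x => x :: ts), lsum_map]

theorem insSum_const {β : Type*} (x : β) (c : ℝ) (l : List β) :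
    insSum x (fun _ => c) l = (l.length + 1) * c := by
  induction l with
  | nil => simp [insSum]
  | cons y ys ih => simp only [insSum, ih, List.length_cons]; push_cast; ring

/-- The total weight of all moves depends only on the size of the tree. -/
theorem lsum_moves_one (a η : ℝ) (T : FTree) :
    lsum (moves a η T) (fun _ => 1) = size T - η := by
  induction T using induction_subtrees with
  | h l ih =>
    have key : ∀ l : List FTree,
        (∀ t ∈ l, lsum (moves a η t) (fun _ => 1) = size t - η) →
        lsum (movesList a η l) (fun _ => 1) = ((l.map size).sum : ℕ) - l.length * η := by
      intro l hl
      induction l with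
      | nil => simp [lsum_movesList_nil]
      | cons t ts ih =>
        rw [lsum_movesList_cons, ih fun s hs => hl s (by simp [hs]), hl t (by simp)]
        simp only [List.map_cons, List.sum_cons, List.length_cons]
        push_cast
        ring
    by_cases hl : l = []
    · subst hl
      have := lsum_moves_edge a η fun _ => 1
      simp only [edge] at this
      rw [this, size_node]
      simp
    -- With `r` subtrees the weights are `a` for the root edge, `η (r + 1) + 1 - 2 η - a` for `v`,
    -- and the sum of the sizes minus `r η` below; `a` and `r` cancel.
    · rw [lsum_moves_node a η _ hl, key l ih, insSum_const, size_node, attachWeight]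
      have : (l.length : ℝ) + 1 ≠ 0 := by positivity
      push_cast
      field_simp
      ring

theorem size_insertIdx (j : ℕ) (l : List FTree) (hj : j ≤ l.length) :
    ((l.insertIdx j edge).map size).sum = (l.map size).sum + 1 := by
  induction l generalizing j with
  | nil => obtain rfl : j = 0 := by simpa using hj
           simp
  | cons t ts ih =>
    cases j with
    | zero => simp; ring
    | succ j => simp [ih j (by simpa using hj), add_assoc]

theorem size_of_mem_moves (a η : ℝ) (T : FTree) :
    ∀ p ∈ moves a η T, size p.2 = size T + 1 := by
  induction T using induction_subtrees with
  | h l ih =>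
    have key : ∀ l : List FTree, (∀ t ∈ l, ∀ p ∈ moves a η t, size p.2 = size t + 1) →
        ∀ p ∈ movesList a η l, (p.2.map size).sum = (l.map size).sum + 1 := by
      intro l hl
      induction l with
      | nil => simp [movesList]
      | cons t ts ih =>
        intro p hp
        simp only [movesList, List.mem_append, List.mem_map] at hp
        rcases hp with ⟨q, hq, rfl⟩ | ⟨q, hq, rfl⟩
        · simp [hl t (by simp) q hq]; ring
        · simp [ih (fun s hs => hl s (by simp [hs])) q hq]; ring
    intro p hp
    simp only [moves, List.mem_cons, List.mem_append, List.mem_map] at hp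
    rcases hp with rfl | hp | ⟨q, hq, rfl⟩
    · simp [size_node]
    · by_cases hl : l = []
      · simp [hl] at hp
      · simp only [List.isEmpty_iff, hl, if_false, List.mem_map, List.mem_range] at hp
        obtain ⟨j, hj, rfl⟩ := hp
        simp [size_node, size_insertIdx j l (by omega)]
    · simp [size_node, key l ih q hq]

/-- All vertex degrees are at most `D`. -/
inductive DegreeLE (D : ℕ∞) : FTree → Prop
  | node (l : List FTree) : ((l.length + 1 : ℕ) : ℕ∞) ≤ D → (∀ t ∈ l, DegreeLE D t) →
      DegreeLE D (node l)

end FTree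

-- Admissible parameters and nonnegativity of the weights

open FTree

/-- The parameters for which the growth process is well defined, with `η` in place of the parameter
`γ`: all selection weights are nonnegative for trees with degrees at most `D`, and no edge is
attached to a vertex of degree `D`. -/
structure Admissible (a η : ℝ) (D : ℕ∞) : Prop where
  pos : 0 < a
  le_one : a ≤ 1
  eta_le : η ≤ 1
  three_le : 3 ≤ D
  weight_nonneg : ∀ k : ℕ, 2 ≤ k → (k : ℕ∞) ≤ D → 0 ≤ η * k + 1 - 2 * η - a
  weight_eq_zero : ∀ k : ℕ, (k : ℕ∞) = D → η * k + 1 - 2 * η - a = 0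
  eta_pos : D = ⊤ → 0 < η

theorem DegreeLE_edge {D : ℕ∞} (hD : 3 ≤ D) : DegreeLE D edge :=
  DegreeLE.node [] (le_trans (by norm_num) hD) (by simp)

theorem DegreeLE_node_singleton {D : ℕ∞} (hD : 3 ≤ D) {T : FTree} (h : DegreeLE D T) :
    DegreeLE D (node [T]) :=
  DegreeLE.node [T] (le_trans (by norm_num) hD) (by simpa using h)

namespace Admissible
variable {a η : ℝ} {D : ℕ∞} (h : Admissible a η D)
include h

/-- The alternative of weight zero is needed: attaching at a vertex of degree exactly `D` is listed
among the moves and breaks the degree bound, but its weight vanishes. -/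
theorem moves_nonneg (T : FTree) :
    DegreeLE D T → ∀ p ∈ moves a η T, 0 ≤ p.1 ∧ (p.1 = 0 ∨ DegreeLE D p.2) := by
  induction T using induction_subtrees with
  | h l ih =>
    have key : ∀ l : List FTree, (∀ t ∈ l, ∀ p ∈ moves a η t, 0 ≤ p.1 ∧ (p.1 = 0 ∨ DegreeLE D p.2)) →
        (∀ t ∈ l, DegreeLE D t) → ∀ p ∈ movesList a η l, 0 ≤ p.1 ∧ p.2.length = l.length ∧
          (p.1 = 0 ∨ ∀ t ∈ p.2, DegreeLE D t) := by
      intro l hl hd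
      induction l with
      | nil => simp [movesList]
      | cons t ts ih =>
        intro p hp
        simp only [movesList, List.mem_append, List.mem_map] at hp
        rcases hp with ⟨q, hq, rfl⟩ | ⟨q, hq, rfl⟩
        · have := hl t (by simp) q hq
          refine ⟨this.1, by simp, this.2.imp id fun h' => ?_⟩
          simp only [List.mem_cons, forall_eq_or_imp] at hd ⊢
          exact ⟨h', hd.2⟩
        · have := ih (fun s hs => hl s (by simp [hs])) (fun s hs => hd s (by simp [hs])) q hq
          refine ⟨this.1, by simp [this.2.1], this.2.2.imp id fun h' => ?_⟩
          simp only [List.mem_cons, forall_eq_or_imp] at hd ⊢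
          exact ⟨hd.1, h'⟩
    intro hT p hp
    obtain ⟨_, hlen, hsub⟩ := hT
    simp only [moves, List.mem_cons, List.mem_append, List.mem_map] at hp
    rcases hp with rfl | hp | ⟨q, hq, rfl⟩
    · refine ⟨?_, Or.inr (DegreeLE_node_singleton h.three_le (DegreeLE.node l hlen hsub))⟩
      have := h.pos
      have := h.eta_le
      dsimp only
      split_ifs <;> linarith
    · by_cases hl : l = []
      · simp [hl] at hp
      · simp only [List.isEmpty_iff, hl, if_false, List.mem_map, List.mem_range] at hp
        obtain ⟨j, hj, rfl⟩ := hp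
        have hl1 : 1 ≤ l.length := by
          rcases l with _ | _ <;> simp_all
        have hw := h.weight_nonneg (l.length + 1) (by omega) hlen
        push_cast at hw
        refine ⟨div_nonneg hw (by positivity), ?_⟩
        rcases hlen.lt_or_eq with hlt | heq
        · right
          refine DegreeLE.node _ ?_ ?_
          · rw [List.length_insertIdx_of_le_length (by omega)]
            push_cast at hlt ⊢
            exact Order.add_one_le_of_lt hlt
          · intro t ht
            rcases List.eq_or_mem_of_mem_insertIdx ht with rfl | ht
            · exact DegreeLE_edge h.three_le
            · exact hsub t ht
        · left
          have := h.weight_eq_zero _ heq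
          push_cast at this
          simp [this]
    · have := key l (fun t ht => ih t ht (hsub t ht)) hsub q hq
      refine ⟨this.1, this.2.2.imp id fun h' => DegreeLE.node _ ?_ h'⟩
      rw [this.2.1]; exact hlen

end Admissible

-- The law of the growth process

/-- The law of the growth process when the tree has `n` edges, as a finite weighted sum of trees. -/
def growthLaw (a η : ℝ) : ℕ → List (ℝ × FTree)
  | 0 => []
  | 1 => [(1, edge)]
  | 2 => [(1, node [edge])]
  | n + 3 => (growthLaw a η (n + 2)).flatMap fun p =>
      (moves a η p.2).map fun q => (p.1 * q.1 / ((n : ℝ) + 2 - η), q.2)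

/-- The expectation of `F` under the law of the growth process at size `n`. -/
def expect (a η : ℝ) (n : ℕ) (F : FTree → ℝ) : ℝ := lsum (growthLaw a η n) F

@[simp] theorem expect_one_edge (a η : ℝ) (F : FTree → ℝ) : expect a η 1 F = F edge := by
  simp [expect, growthLaw]

@[simp] theorem expect_two (a η : ℝ) (F : FTree → ℝ) : expect a η 2 F = F (node [edge]) := by
  simp [expect, growthLaw]

theorem size_of_mem_growthLaw (a η : ℝ) (n : ℕ) : ∀ p ∈ growthLaw a η n, size p.2 = n := by
  induction n using growthLaw.induct with
  | case1 => simp [growthLaw]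
  | case2 => simp [growthLaw]
  | case3 => simp [growthLaw, size_node]
  | case4 n ih =>
    intro p hp
    simp only [growthLaw, List.mem_flatMap, List.mem_map] at hp
    obtain ⟨q, hq, r, hr, rfl⟩ := hp
    simp [size_of_mem_moves a η _ r hr, ih q hq]

theorem expect_congr {a η : ℝ} {n : ℕ} {F G : FTree → ℝ} (h : ∀ T, size T = n → F T = G T) :
    expect a η n F = expect a η n G :=
  lsum_congr fun p hp => h _ (size_of_mem_growthLaw a η n p hp)

namespace Admissible
variable {a η : ℝ} {D : ℕ∞} (h : Admissible a η D)
include h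

/-- Keeping `n - η` as a factor on the left makes the case `n = 1` true even for `η = 1`, when both
sides vanish. That case is needed for subtrees that are single edges. -/
theorem expect_succ {n : ℕ} (hn : 1 ≤ n) (F : FTree → ℝ) :
    ((n : ℝ) - η) * expect a η (n + 1) F = expect a η n fun T => lsum (moves a η T) F := by
  obtain _ | _ | n := n
  · omega
  · simp [lsum_moves_edge]
  · have hη := h.eta_le
    have hne : (n : ℝ) + 2 - η ≠ 0 := by
      have : (0 : ℝ) ≤ n := by positivity
      intro h0
      linarith
    simp only [expect, growthLaw, lsum_flatMap]
    push_cast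
    field_simp
    ring

theorem growthLaw_nonneg (n : ℕ) :
    ∀ p ∈ growthLaw a η n, 0 ≤ p.1 ∧ (p.1 = 0 ∨ DegreeLE D p.2) := by
  induction n using growthLaw.induct with
  | case1 => simp [growthLaw]
  | case2 => simp [growthLaw, DegreeLE_edge h.three_le]
  | case3 => simp [growthLaw, DegreeLE_node_singleton h.three_le (DegreeLE_edge h.three_le)]
  | case4 n ih =>
    intro p hp
    simp only [growthLaw, List.mem_flatMap, List.mem_map] at hp
    obtain ⟨q, hq, r, hr, rfl⟩ := hp
    have hd : 0 ≤ (n : ℝ) + 2 - η := by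
      have := h.eta_le
      have : (0 : ℝ) ≤ n := by positivity
      linarith
    obtain ⟨h0, h1⟩ := ih q hq
    rcases h1 with h1 | h1
    · simp [h1]
    · obtain ⟨h2, h3⟩ := h.moves_nonneg q.2 h1 r hr
      refine ⟨by positivity, h3.imp (fun h3 => by simp [h3]) id⟩

theorem expect_mono {n : ℕ} {F G : FTree → ℝ} (hFG : ∀ T, size T = n → F T ≤ G T) :
    expect a η n F ≤ expect a η n G :=
  lsum_mono fun p hp => ⟨(h.growthLaw_nonneg n p hp).1, hFG _ (size_of_mem_growthLaw a η n p hp)⟩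

theorem expect_nonneg {n : ℕ} {F : FTree → ℝ} (hF : ∀ T, 0 ≤ F T) : 0 ≤ expect a η n F := by
  have := h.expect_mono (n := n) (F := fun _ => 0) (G := F) fun T _ => hF T
  simpa [expect, lsum] using this

theorem expect_one {n : ℕ} (hn : 1 ≤ n) : expect a η n (fun _ => 1) = 1 := by
  induction n, hn using Nat.le_induction with
  | base => simp
  | succ n hn ih =>
    obtain rfl | hn2 := hn.eq_or_lt
    · simp
    have hη := h.eta_le
    have hne : (n : ℝ) - η ≠ 0 := by
      have : (2 : ℝ) ≤ n := by exact_mod_cast hn2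
      intro h0
      linarith
    have := h.expect_succ hn fun _ => 1
    simp only [lsum_moves_one] at this
    rw [expect_congr (n := n) (F := fun T => (size T : ℝ) - η) (G := fun _ => ((n : ℝ) - η) * 1)
      fun T hT => by rw [hT, mul_one]] at this
    rw [expect, expect, lsum_const_mul] at this
    exact mul_left_cancel₀ hne (this.trans (by rw [← expect, ih]))

end Admissible

theorem expect_const_mul (a η : ℝ) (n : ℕ) (c : ℝ) (F : FTree → ℝ) :
    expect a η n (fun x => c * F x) = c * expect a η n F := lsum_const_mul _ _ _

theorem expect_add (a η : ℝ) (n : ℕ) (F G : FTree → ℝ) :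
    expect a η n (fun x => F x + G x) = expect a η n F + expect a η n G := lsum_add _ _ _

-- The denominator of `growProb` is the constant `n - η` by `lsum_moves_one`, so the recursion for
-- `nu` is that of `growthLaw`.
open Classical in
theorem nu_eq (a g : ℝ) (D : ℕ∞) (n : ℕ) :
    ∀ T, nu a g D n T = expect a (eta a g D) n fun S => if S = T then 1 else 0 := by
  induction n using growthLaw.induct with
  | case1 => simp [nu, expect, growthLaw]
  | case2 => simp [nu, eq_comm]
  | case3 => simp [nu, eq_comm]
  | case4 n ih =>
    intro T
    simp only [nu, ih]
    simp only [expect]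
    rw [(hasSum_lsum _ _).tsum_eq]
    rw [lsum_congr (G := fun S => lsum (moves a (eta a g D) S) (fun S => if S = T then 1 else 0)
      * (((n : ℝ) + 2 - eta a g D))⁻¹), lsum_mul_const, growthLaw, lsum_flatMap, div_eq_mul_inv]
    intro p hp
    have h1 := lsum_moves_one a (eta a g D) p.2
    rw [size_of_mem_growthLaw _ _ _ p hp] at h1
    simp only [lsum, mul_one] at h1 ⊢
    rw [growProb, h1]
    push_cast
    simp [div_eq_mul_inv]

theorem hasSum_nu_mul (a g : ℝ) (D : ℕ∞) (n : ℕ) (F : FTree → ℝ) :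
    HasSum (fun T => nu a g D n T * F T) (expect a (eta a g D) n F) := by
  classical
  simp only [nu_eq]
  exact hasSum_lsum _ _

/-! ### The Markov branching property -/

/-- The expectation of `Ψ` for a list of independent trees with the given sizes. -/
def expectList (a η : ℝ) : List ℕ → (List FTree → ℝ) → ℝ
  | [], Ψ => Ψ []
  | n :: ns, Ψ => expect a η n fun t => expectList a η ns fun ts => Ψ (t :: ts)

/-- The sum over all ways of increasing one entry `n` of a list by one, with weights `n - η`. -/
def incSum (η : ℝ) : (List ℕ → ℝ) → List ℕ → ℝ
  | _, [] => 0
  | φ, n :: ns => ((n : ℝ) - η) * φ ((n + 1) :: ns) + incSum η (fun l => φ (n :: l)) ns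

section expectList
variable (a η : ℝ)

theorem expectList_add (ns : List ℕ) (Ψ Φ : List FTree → ℝ) :
    expectList a η ns (fun l => Ψ l + Φ l) = expectList a η ns Ψ + expectList a η ns Φ := by
  induction ns generalizing Ψ Φ with
  | nil => rfl
  | cons n ns ih => simp only [expectList, ih, expect_add]

theorem expectList_const_mul (ns : List ℕ) (c : ℝ) (Ψ : List FTree → ℝ) :
    expectList a η ns (fun l => c * Ψ l) = c * expectList a η ns Ψ := by
  induction ns generalizing Ψ with
  | nil => rfl
  | cons n ns ih => simp only [expectList, ih, expect_const_mul]

theorem expectList_lsum {β : Type*} (ns : List ℕ) (d : List (ℝ × β))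
    (Ψ : β → List FTree → ℝ) :
    expectList a η ns (fun l => lsum d fun y => Ψ y l) = lsum d fun y => expectList a η ns (Ψ y) := by
  induction d with
  | nil => simpa using expectList_const_mul a η ns 0 fun _ => 0
  | cons p d ih => simp only [lsum_cons, expectList_add, expectList_const_mul, ih]

theorem expectList_congr {ns : List ℕ} {Ψ Φ : List FTree → ℝ}
    (h : ∀ l : List FTree, l.map size = ns → Ψ l = Φ l) :
    expectList a η ns Ψ = expectList a η ns Φ := by
  induction ns generalizing Ψ Φ with
  | nil => exact h [] rfl
  | cons n ns ih =>
    exact expect_congr fun t ht => ih fun l hl => h (t :: l) (by simp [ht, hl])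

theorem lsum_insSum {β κ : Type*} (x : κ) (d : List (ℝ × β)) (φ : β → List κ → ℝ) (l : List κ) :
    lsum d (fun t => insSum x (φ t) l) = insSum x (fun ms => lsum d fun t => φ t ms) l := by
  induction l generalizing φ with
  | nil => rfl
  | cons y ys ih => simp only [insSum, lsum_add, ih]

theorem lsum_incSum {β : Type*} (d : List (ℝ × β)) (φ : β → List ℕ → ℝ) (l : List ℕ) :
    lsum d (fun t => incSum η (φ t) l) = incSum η (fun ms => lsum d fun t => φ t ms) l := by
  induction l generalizing φ with
  | nil => simp [incSum, lsum]
  | cons y ys ih => simp only [incSum, lsum_add, lsum_const_mul, ih]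

/-- The law at size one is the point mass at `edge`, so inserting an edge among the trees amounts to
inserting a `1` among the sizes. -/
theorem expectList_insSum (ns : List ℕ) (Ψ : List FTree → ℝ) :
    expectList a η ns (insSum edge Ψ) = insSum 1 (fun ms => expectList a η ms Ψ) ns := by
  induction ns generalizing Ψ with
  | nil => simp [expectList, insSum]
  | cons n ns ih =>
    simp only [expectList, insSum, expectList_add, expect_add, expect_one_edge]
    congr 1
    simp only [ih]
    exact lsum_insSum 1 _ _ _

theorem insSum_map_size (φ : List ℕ → ℝ) (l : List FTree) :
    insSum edge (fun l => φ (l.map size)) l = insSum 1 φ (l.map size) := by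
  induction l generalizing φ with
  | nil => simp [insSum]
  | cons t ts ih =>
    simp only [insSum, List.map_cons, size_edge]
    rw [← ih]

/-- The moves inside a subtree of size `m` have total weight `m - η`, and each raises its size by
one. -/
theorem lsum_movesList_sizes (φ : List ℕ → ℝ) (l : List FTree) :
    lsum (movesList a η l) (fun l => φ (l.map size)) = incSum η φ (l.map size) := by
  induction l generalizing φ with
  | nil => simp [lsum_movesList_nil, incSum]
  | cons t ts ih =>
    simp only [lsum_movesList_cons, List.map_cons, incSum]
    rw [← ih]
    congr 1
    rw [lsum_congr (G := fun _ => φ ((size t + 1) :: ts.map size) * 1)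
      fun p hp => by rw [size_of_mem_moves a η t p hp, mul_one], lsum_const_mul, lsum_moves_one,
      mul_comm]

theorem lsum_moves_sizes (φ : List ℕ → ℝ) {l : List FTree} (hl : l ≠ []) :
    lsum (moves a η (node l)) (fun T => φ (T.subtrees.map size)) = a * φ [size (node l)]
      + attachWeight a η l.length * insSum 1 φ (l.map size) + incSum η φ (l.map size) := by
  rw [lsum_moves_node a η _ hl, ← insSum_map_size, ← lsum_movesList_sizes a]
  rfl

end expectList

theorem subtrees_ne_nil {T : FTree} (h : 2 ≤ size T) : T.subtrees ≠ [] := by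
  obtain ⟨_ | ⟨_, _⟩⟩ := T
  · simp [size_node] at h
  · simp [subtrees]

namespace Admissible
variable {a η : ℝ} {D : ℕ∞} (h : Admissible a η D)
include h

theorem expectList_movesList {ns : List ℕ} (hns : ∀ n ∈ ns, 1 ≤ n) (Ψ : List FTree → ℝ) :
    expectList a η ns (fun l => lsum (movesList a η l) Ψ)
      = incSum η (fun ms => expectList a η ms Ψ) ns := by
  induction ns generalizing Ψ with
  | nil => simp [expectList, incSum, lsum_movesList_nil]
  | cons n ns ih =>
    simp only [expectList, incSum, lsum_movesList_cons, expectList_add, expect_add]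
    congr 1
    · simp only [expectList_lsum]
      rw [h.expect_succ (hns n (by simp))]
    · simp only [ih fun m hm => hns m (by simp [hm])]
      exact lsum_incSum η _ _ _

theorem sub_ne_zero {n : ℕ} (hn : 2 ≤ n) : (n : ℝ) - η ≠ 0 := by
  have : (2 : ℝ) ≤ n := by exact_mod_cast hn
  have := h.eta_le
  intro h0
  linarith

/-- One step of the growth process, seen through the sizes of the subtrees. -/
theorem expect_succ_sizes {n : ℕ} (hn : 2 ≤ n) (φ : List ℕ → ℝ) :
    ((n : ℝ) - η) * expect a η (n + 1) (fun T => φ (T.subtrees.map size))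
      = a * φ [n] + expect a η n fun T => attachWeight a η T.subtrees.length
          * insSum 1 φ (T.subtrees.map size) + incSum η φ (T.subtrees.map size) := by
  rw [h.expect_succ (by omega), expect_congr (n := n)
    (G := fun T => a * φ [n] * 1 + (attachWeight a η T.subtrees.length
          * insSum 1 φ (T.subtrees.map size) + incSum η φ (T.subtrees.map size))),
    expect_add, expect_const_mul, h.expect_one (by omega), mul_one]
  intro T hT
  have := lsum_moves_sizes a η φ (subtrees_ne_nil (T := T) (by omega))
  rw [node_subtrees, hT] at this
  rw [this]
  ring

/-- Given their sizes, the subtrees planted at the neighbour of the root are independent and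
distributed as trees grown by the same process. -/
theorem expect_eq_expectList {n : ℕ} (hn : 2 ≤ n) (F : FTree → ℝ) :
    expect a η n F
      = expect a η n fun T => expectList a η (T.subtrees.map size) fun l => F (node l) := by
  induction n, hn using Nat.le_induction generalizing F with
  | base => simp [subtrees, expectList]
  | succ n hn ih =>
    -- Expand both sides by one growth step and match the three kinds of moves. The root-edge term
    -- uses the induction hypothesis for `F` composed with `node [·]`; the other two use
    -- `expectList_insSum` and `expectList_movesList`.
    refine mul_left_cancel₀ (h.sub_ne_zero hn) ?_
    rw [h.expect_succ_sizes hn fun ms => expectList a η ms fun l => F (node l),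
      h.expect_succ (by omega), ih, expect_congr (n := n)
      (G := fun T => a * expectList a η (T.subtrees.map size) (fun l => F (node [node l]))
        + (attachWeight a η T.subtrees.length * insSum 1
            (fun ms => expectList a η ms fun l => F (node l)) (T.subtrees.map size)
          + incSum η (fun ms => expectList a η ms fun l => F (node l)) (T.subtrees.map size))),
      expect_add, expect_const_mul, ← ih fun T => F (node [T])]
    · rfl
    intro T hT
    have hne := subtrees_ne_nil (T := T) (by omega)
    rw [← expectList_insSum, ← h.expectList_movesList, ← expectList_const_mul,
      ← expectList_const_mul, ← expectList_add, ← expectList_add]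
    · refine expectList_congr a η fun l hl => ?_
      have hlen : l.length = T.subtrees.length := by simpa using congrArg List.length hl
      rw [lsum_moves_node a η F (by rintro rfl; exact hne (by simpa using hlen.symm)), hlen]
      ring
    · intro k hk
      obtain ⟨t, -, rfl⟩ := List.mem_map.1 hk
      exact size_pos t

end Admissible

/-! ### The sizes of the subtrees -/

/-- The indicator function of the list `ms`. -/
def ind (ms ns : List ℕ) : ℝ := if ns = ms then 1 else 0

/-- The sum over all ways of erasing an entry `1` from a list. -/
def eraseSum : (List ℕ → ℝ) → List ℕ → ℝ
  | _, [] => 0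
  | f, m :: ms => (if m = 1 then f ms else 0) + eraseSum (fun l => f (m :: l)) ms

/-- The sum over all ways of decreasing one entry `m` of a list by one, with weights
`m - 1 - η`. -/
def decSum (η : ℝ) : (List ℕ → ℝ) → List ℕ → ℝ
  | _, [] => 0
  | f, m :: ms => ((m : ℝ) - 1 - η) * f ((m - 1) :: ms) + decSum η (fun l => f (m :: l)) ms

theorem ind_cons (m n : ℕ) (ms ns : List ℕ) :
    ind (m :: ms) (n :: ns) = if n = m then ind ms ns else 0 := by
  by_cases h : n = m <;> simp [ind, h]

theorem insSum_zero {β : Type*} (x : β) (l : List β) : insSum x (fun _ => 0) l = 0 := by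
  rw [insSum_const, mul_zero]

theorem eraseSum_zero (l : List ℕ) : eraseSum (fun _ => 0) l = 0 := by
  induction l with
  | nil => rfl
  | cons m ms ih => simp [eraseSum, ih]

theorem decSum_zero (η : ℝ) (l : List ℕ) : decSum η (fun _ => 0) l = 0 := by
  induction l with
  | nil => rfl
  | cons m ms ih => simp [decSum, ih]

theorem incSum_zero (η : ℝ) (l : List ℕ) : incSum η (fun _ => 0) l = 0 := by
  induction l with
  | nil => rfl
  | cons m ms ih => simp [incSum, ih]

/-- Transposition: inserting a `1` into `ns` produces `ms` in as many ways as erasing a `1` from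
`ms` produces `ns`. This turns the backward equation for expectations into a forward equation for
probabilities. -/
theorem insSum_ind (ms ns : List ℕ) :
    insSum 1 (ind ms) ns = eraseSum (fun l => ind l ns) ms := by
  induction ms generalizing ns with
  | nil =>
    cases ns with
    | nil => simp [insSum, eraseSum, ind]
    | cons n ns =>
      simp only [insSum, eraseSum, ind]
      simpa using insSum_zero 1 ns
  | cons m ms ih =>
    cases ns with
    | nil =>
      have : eraseSum (fun l => ind (m :: l) []) ms = 0 := by simpa [ind] using eraseSum_zero ms
      simp only [insSum, eraseSum, this, ind_cons, add_zero, eq_comm]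
    | cons n ns =>
      simp only [insSum, eraseSum, ind_cons, eq_comm (a := m)]
      congr 1
      by_cases hn : n = m
      · simp only [hn, if_true]
        exact ih ns
      · simpa [hn, insSum_zero] using (eraseSum_zero ms).symm

/-- The analogous transposition for growth of one entry. The weight `n - η` reads `m - 1 - η` in
terms of the target `m = n + 1`; positivity of the entries makes the truncated `m - 1` harmless. -/
theorem incSum_ind (η : ℝ) {ms : List ℕ} (hms : ∀ m ∈ ms, 1 ≤ m) (ns : List ℕ) :
    incSum η (ind ms) ns = decSum η (fun l => ind l ns) ms := by
  induction ms generalizing ns with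
  | nil =>
    cases ns with
    | nil => simp [incSum, decSum]
    | cons n ns =>
      simp only [incSum, decSum, ind]
      simpa using incSum_zero η ns
  | cons m ms ih =>
    have hm := hms m (by simp)
    cases ns with
    | nil =>
      have : decSum η (fun l => ind (m :: l) []) ms = 0 := by simpa [ind] using decSum_zero η ms
      simp only [incSum, decSum, this]
      simp [ind]
    | cons n ns =>
      simp only [incSum, decSum, ind_cons]
      congr 1
      · by_cases hn : n + 1 = m
        · subst hn; simp
        · have : n ≠ m - 1 := by omega
          simp [hn, this]
      · by_cases hn : n = m
        · simp only [hn, if_true]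
          exact ih (fun k hk => hms k (by simp [hk])) ns
        · simpa [hn, incSum_zero] using (decSum_zero η ms).symm

/-- Allows the attachment weight, which depends on the degree in the current tree, to be read off
from the length of the target list. -/
theorem insSum_ind_of_length_ne {ms ns : List ℕ} (hl : ns.length + 1 ≠ ms.length) :
    insSum 1 (ind ms) ns = 0 := by
  induction ns generalizing ms with
  | nil =>
    have : [1] ≠ ms := by rintro rfl; simp at hl
    simp [insSum, ind, this]
  | cons n ns ih =>
    have h1 : 1 :: n :: ns ≠ ms := by rintro rfl; simp at hl
    rw [insSum]
    cases ms with
    | nil => simp only [ind]; simpa using insSum_zero 1 ns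
    | cons m ms =>
      simp only [ind_cons]
      by_cases hn : n = m
      · simp only [hn, if_true]
        have : ind ms (m :: ns) = 0 := if_neg fun h => by subst h; simp at hl
        have h2 : insSum 1 (fun l => ind ms l) ns = 0 := ih (by simpa using hl)
        rw [this, h2]
        simp
      · simp only [hn, if_false, insSum_zero]
        have : ind ms (n :: ns) = 0 := if_neg fun h => by subst h; simp at hl
        simp [this]

theorem lsum_eraseSum {β : Type*} (d : List (ℝ × β)) (φ : β → List ℕ → ℝ) (l : List ℕ) :
    lsum d (fun t => eraseSum (φ t) l) = eraseSum (fun ms => lsum d fun t => φ t ms) l := by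
  induction l generalizing φ with
  | nil => simp [eraseSum, lsum]
  | cons y ys ih =>
    simp only [eraseSum, lsum_add, ih]
    split_ifs
    · rfl
    · simp [lsum]

theorem lsum_decSum {β : Type*} (η : ℝ) (d : List (ℝ × β)) (φ : β → List ℕ → ℝ) (l : List ℕ) :
    lsum d (fun t => decSum η (φ t) l) = decSum η (fun ms => lsum d fun t => φ t ms) l := by
  induction l generalizing φ with
  | nil => simp [decSum, lsum]
  | cons y ys ih => simp only [decSum, lsum_add, lsum_const_mul, ih]

theorem eraseSum_append (f : List ℕ → ℝ) (A : List ℕ) (m : ℕ) (B : List ℕ) :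
    eraseSum f (A ++ m :: B) = eraseSum (fun l => f (l ++ m :: B)) A
      + (if m = 1 then f (A ++ B) else 0) + eraseSum (fun l => f (A ++ m :: l)) B := by
  induction A generalizing f with
  | nil => simp [eraseSum]
  | cons k A ih => simp only [List.cons_append, eraseSum, ih]; ring

theorem decSum_append (η : ℝ) (f : List ℕ → ℝ) (A : List ℕ) (m : ℕ) (B : List ℕ) :
    decSum η f (A ++ m :: B) = decSum η (fun l => f (l ++ m :: B)) A
      + ((m : ℝ) - 1 - η) * f (A ++ (m - 1) :: B) + decSum η (fun l => f (A ++ m :: l)) B := by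
  induction A generalizing f with
  | nil => simp [decSum]
  | cons k A ih => simp only [List.cons_append, decSum, ih]; ring

/-- Only lists of smaller total are evaluated, so convergence on these suffices; this feeds the
strong induction in `Admissible.tendsto_sizeProb`. -/
theorem tendsto_eraseSum {f : ℕ → List ℕ → ℝ} {g : List ℕ → ℝ} (A : List ℕ)
    (hf : ∀ l : List ℕ, l.sum + 1 = A.sum → l.length + 1 = A.length →
      Tendsto (fun m => f m l) atTop (𝓝 (g l))) :
    Tendsto (fun m => eraseSum (f m) A) atTop (𝓝 (eraseSum g A)) := by
  induction A generalizing f g with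
  | nil => exact tendsto_const_nhds
  | cons k A ih =>
    refine Tendsto.add ?_ (ih fun l hl hl' => hf _ (by simp; omega) (by simp [hl']))
    split_ifs with hk
    · exact hf A (by simp [hk, add_comm]) (by simp)
    · exact tendsto_const_nhds

theorem tendsto_decSum (η : ℝ) {f : ℕ → List ℕ → ℝ} {g : List ℕ → ℝ} {A : List ℕ}
    (hA : ∀ m ∈ A, 1 ≤ m) (hf : ∀ l : List ℕ, l.sum + 1 = A.sum → l.length = A.length →
      Tendsto (fun m => f m l) atTop (𝓝 (g l))) :
    Tendsto (fun m => decSum η (f m) A) atTop (𝓝 (decSum η g A)) := by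
  induction A generalizing f g with
  | nil => exact tendsto_const_nhds
  | cons k A ih =>
    have hk := hA k (by simp)
    refine Tendsto.add ((hf _ (by simp; omega) (by simp)).const_mul _)
      (ih (fun m hm => hA m (by simp [hm])) fun l hl hl' => hf _ (by simp; omega) (by simp [hl']))

theorem eraseSum_congr {f g : List ℕ → ℝ} (A : List ℕ)
    (hf : ∀ l : List ℕ, l.sum + 1 = A.sum → l.length + 1 = A.length → f l = g l) :
    eraseSum f A = eraseSum g A :=
  tendsto_nhds_unique tendsto_const_nhds
    (tendsto_eraseSum (f := fun _ => f) A fun l h1 h2 => hf l h1 h2 ▸ tendsto_const_nhds)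

theorem decSum_congr (η : ℝ) {f g : List ℕ → ℝ} {A : List ℕ} (hA : ∀ m ∈ A, 1 ≤ m)
    (hf : ∀ l : List ℕ, l.sum + 1 = A.sum → l.length = A.length → f l = g l) :
    decSum η f A = decSum η g A :=
  tendsto_nhds_unique tendsto_const_nhds
    (tendsto_decSum η (f := fun _ => f) hA fun l h1 h2 => hf l h1 h2 ▸ tendsto_const_nhds)

theorem eraseSum_const_mul (c : ℝ) (f : List ℕ → ℝ) (A : List ℕ) :
    eraseSum (fun l => c * f l) A = c * eraseSum f A := by
  have := lsum_eraseSum [(c, ())] (fun _ => f) A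
  simpa using this.symm

theorem decSum_const_mul (η c : ℝ) (f : List ℕ → ℝ) (A : List ℕ) :
    decSum η (fun l => c * f l) A = c * decSum η f A := by
  have := lsum_decSum η [(c, ())] (fun _ => f) A
  simpa using this.symm

/-- The probability that the subtrees planted at the neighbour of the root have sizes `ms`. -/
def sizeProb (a η : ℝ) (n : ℕ) (ms : List ℕ) : ℝ :=
  expect a η n fun T => ind ms (T.subtrees.map size)

theorem Admissible.sizeProb_succ {a η : ℝ} {D : ℕ∞} (h : Admissible a η D) {n : ℕ} (hn : 2 ≤ n)
    {ms : List ℕ} (hms : ∀ m ∈ ms, 1 ≤ m) :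
    ((n : ℝ) - η) * sizeProb a η (n + 1) ms = a * ind ms [n]
      + attachWeight a η (ms.length - 1) * eraseSum (sizeProb a η n) ms
      + decSum η (sizeProb a η n) ms := by
  rw [sizeProb, h.expect_succ_sizes hn, expect_congr (G := fun T =>
    attachWeight a η (ms.length - 1) * eraseSum (fun l => ind l (T.subtrees.map size)) ms
      + decSum η (fun l => ind l (T.subtrees.map size)) ms), expect_add, expect_const_mul, add_assoc]
  · congr 3
    · exact lsum_eraseSum _ _ _
    · exact lsum_decSum _ _ _ _
  · intro T _
    rw [incSum_ind η hms, ← insSum_ind]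
    congr 1
    by_cases hl : T.subtrees.length + 1 = ms.length
    · rw [← hl, Nat.add_sub_cancel]
    · rw [insSum_ind_of_length_ne (by simpa using hl)]
      simp

/-! ### The limit of the first split -/

/-- The numbers `(1 - η)(2 - η) ⋯ (m - 1 - η) / m!` for `m ≥ 1`. -/
def splitCoeff (η : ℝ) : ℕ → ℝ
  | 0 => 0
  | 1 => 1
  | m + 2 => ((m : ℝ) + 1 - η) / ((m : ℝ) + 2) * splitCoeff η (m + 1)

/-- The product of the weights of `s` successive attachments, at given positions, to a vertex that
originally has one child. -/
def attachProd (a η : ℝ) : ℕ → ℝ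
  | 0 => 1
  | s + 1 => attachProd a η s * attachWeight a η (s + 1)

/-- The limit law of the subtree sizes to the left and to the right of the largest subtree. -/
def limProb (a η : ℝ) (A B : List ℕ) : ℝ :=
  a / ((A.sum + B.sum : ℕ) + 1) * attachProd a η (A.length + B.length)
    * (A.map (splitCoeff η)).prod * (B.map (splitCoeff η)).prod

/-- Each entry `m` contributes `m` times the product. For `m ≥ 2` this is the recursion `m *
splitCoeff η m = (m - 1 - η) * splitCoeff η (m - 1)`; for `m = 1` it comes from erasing, since
`splitCoeff η 0 = 0`. -/
theorem eraseSum_add_decSum (η : ℝ) {A : List ℕ} (hA : ∀ m ∈ A, 1 ≤ m) :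
    eraseSum (fun l => (l.map (splitCoeff η)).prod) A
      + decSum η (fun l => (l.map (splitCoeff η)).prod) A
      = A.sum * (A.map (splitCoeff η)).prod := by
  induction A with
  | nil => simp [eraseSum, decSum]
  | cons m A ih =>
    have ih := ih fun k hk => hA k (by simp [hk])
    simp only [eraseSum, decSum, List.map_cons, List.prod_cons, eraseSum_const_mul,
      decSum_const_mul, List.sum_cons]
    obtain _ | _ | m := m
    · exact absurd (hA 0 (by simp)) (by simp)
    · rw [Nat.cast_add (0 + 1)]
      simp only [splitCoeff, zero_add, if_true, Nat.sub_self, Nat.cast_one]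
      linear_combination ih
    · have : (m : ℝ) + 2 ≠ 0 := by positivity
      simp only [splitCoeff, show m + 1 + 1 ≠ 1 by omega, if_false, Nat.add_sub_cancel]
      rw [Nat.cast_add (m + 1 + 1), show ((m + 1 + 1 : ℕ) : ℝ) = m + 2 by push_cast; ring,
        show (m : ℝ) + 2 - 1 - η = m + 1 - η by ring]
      field_simp
      linear_combination ((m : ℝ) + 1 - η) * splitCoeff η (m + 1) * ih

/-- `limProb` solves the limiting recursion. Every predecessor has total size smaller by one;
erasing also removes one factor of `attachProd`, which the attachment weight restores, and
`eraseSum_add_decSum` supplies the total size as a factor. -/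
theorem limProb_eq (a η : ℝ) {A B : List ℕ} (hA : ∀ m ∈ A, 1 ≤ m) (hB : ∀ m ∈ B, 1 ≤ m)
    (hM : A.sum + B.sum ≠ 0) :
    attachWeight a η (A.length + B.length) * (eraseSum (fun l => limProb a η l B) A
        + eraseSum (fun l => limProb a η A l) B)
      + (decSum η (fun l => limProb a η l B) A + decSum η (fun l => limProb a η A l) B)
      = limProb a η A B * ((A.sum + B.sum : ℕ) + 1) := by
  obtain ⟨M, hM⟩ : ∃ M, A.sum + B.sum = M + 1 := ⟨A.sum + B.sum - 1, by omega⟩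
  obtain ⟨s, hs⟩ : ∃ s, A.length + B.length = s + 1 := by
    refine ⟨A.length + B.length - 1, ?_⟩
    rcases A with _ | _ <;> rcases B with _ | _ <;> simp at hM ⊢
    omega
  set pA := (A.map (splitCoeff η)).prod with hpA
  set pB := (B.map (splitCoeff η)).prod with hpB
  have e1 : eraseSum (fun l => limProb a η l B) A
      = a / ((M : ℝ) + 1) * attachProd a η s * pB
        * eraseSum (fun l => (l.map (splitCoeff η)).prod) A := by
    rw [← eraseSum_const_mul]
    refine eraseSum_congr A fun l h1 h2 => ?_
    rw [limProb, show l.sum + B.sum = M by omega, show l.length + B.length = s by omega]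
    ring
  have e2 : eraseSum (fun l => limProb a η A l) B
      = a / ((M : ℝ) + 1) * attachProd a η s * pA
        * eraseSum (fun l => (l.map (splitCoeff η)).prod) B := by
    rw [← eraseSum_const_mul]
    refine eraseSum_congr B fun l h1 h2 => ?_
    rw [limProb, show A.sum + l.sum = M by omega, show A.length + l.length = s by omega]
  have e3 : decSum η (fun l => limProb a η l B) A
      = a / ((M : ℝ) + 1) * attachProd a η (s + 1) * pB
        * decSum η (fun l => (l.map (splitCoeff η)).prod) A := by
    rw [← decSum_const_mul]
    refine decSum_congr η hA fun l h1 h2 => ?_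
    rw [limProb, show l.sum + B.sum = M by omega, show l.length + B.length = s + 1 by omega]
    ring
  have e4 : decSum η (fun l => limProb a η A l) B
      = a / ((M : ℝ) + 1) * attachProd a η (s + 1) * pA
        * decSum η (fun l => (l.map (splitCoeff η)).prod) B := by
    rw [← decSum_const_mul]
    refine decSum_congr η hB fun l h1 h2 => ?_
    rw [limProb, show A.sum + l.sum = M by omega, show A.length + l.length = s + 1 by omega]
  have h1 := eraseSum_add_decSum η hA
  have h2 := eraseSum_add_decSum η hB
  have h3 : (A.sum : ℝ) + B.sum = M + 1 := by exact_mod_cast hM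
  rw [e1, e2, e3, e4, hs, limProb, hM, hs, ← hpA, ← hpB]
  rw [← hpA] at h1
  rw [← hpB] at h2
  have hM0 : (M : ℝ) + 1 ≠ 0 := by positivity
  have hM1 : (M : ℝ) + 1 + 1 ≠ 0 := by positivity
  simp only [attachProd]
  push_cast
  field_simp
  linear_combination a * attachProd a η s * attachWeight a η (s + 1) *
    (pB * h1 + pA * h2 + pA * pB * h3)

/-- A linear recursion with convergent inhomogeneity. -/
theorem tendsto_of_recursion {η c β : ℝ} (hη : η ≤ 1) (hc : 1 ≤ c) {y b : ℕ → ℝ}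
    (hy : ∀ m : ℕ, 1 ≤ m → ((m : ℝ) + c - η) * y (m + 1) = ((m : ℝ) - η) * y m + b m)
    (hb : Tendsto b atTop (𝓝 β)) : Tendsto y atTop (𝓝 (β / c)) := by
  have hc0 : 0 < c := by linarith
  rw [Metric.tendsto_atTop]
  intro ε hε
  obtain ⟨N, hN⟩ := Metric.tendsto_atTop.1 hb (c * (ε / 2)) (by positivity)
  set N' := max N 2
  -- The excess of the error over `ε / 2`. The product `(m - η) * v m` is eventually nonincreasing,
  -- so `v m` is of order `1 / m`.
  set v : ℕ → ℝ := fun m => max (|y m - β / c| - ε / 2) 0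
  have hv0 : ∀ m, 0 ≤ v m := fun m => le_max_right _ _
  have hpos : ∀ m, N' ≤ m → 0 < (m : ℝ) - η := by
    intro m hm
    have : (2 : ℝ) ≤ m := by exact_mod_cast le_trans (le_max_right _ _) hm
    linarith
  have step : ∀ m, N' ≤ m → ((m + 1 : ℕ) - η) * v (m + 1) ≤ ((m : ℝ) - η) * v m := by
    intro m hm
    have hp := hpos m hm
    have hp1 : (0 : ℝ) ≤ ((m + 1 : ℕ) : ℝ) - η := by push_cast; linarith
    rw [mul_max_of_nonneg _ _ hp1, mul_zero]
    refine max_le ?_ (mul_nonneg hp.le (hv0 m))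
    have h1 := hy m (by have := le_trans (le_max_right N 2) hm; omega)
    have h2 := hN m (le_trans (le_max_left _ _) hm)
    rw [Real.dist_eq] at h2
    have hp2 : 0 < (m : ℝ) + c - η := by linarith
    -- Subtract the recursion's constant solution `β / c`.
    have h3 : ((m : ℝ) + c - η) * (y (m + 1) - β / c)
        = ((m : ℝ) - η) * (y m - β / c) + (b m - β) := by
      field_simp
      linear_combination c * h1
    have h4 : ((m : ℝ) + c - η) * |y (m + 1) - β / c|
        ≤ ((m : ℝ) - η) * |y m - β / c| + c * (ε / 2) := by
      rw [← abs_of_pos hp2, ← abs_mul, h3]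
      refine (abs_add_le _ _).trans (add_le_add ?_ h2.le)
      rw [abs_mul, abs_of_pos hp]
    have h5 : ((m : ℝ) + c - η) * (|y (m + 1) - β / c| - ε / 2)
        ≤ ((m : ℝ) - η) * v m := by
      have : |y m - β / c| - ε / 2 ≤ v m := le_max_left _ _
      nlinarith [mul_le_mul_of_nonneg_left this hp.le]
    rcases le_total 0 (|y (m + 1) - β / c| - ε / 2) with h6 | h6
    · refine le_trans (mul_le_mul_of_nonneg_right ?_ h6) h5
      push_cast
      linarith
    · exact (mul_nonpos_of_nonneg_of_nonpos hp1 h6).trans (mul_nonneg hp.le (hv0 m))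
  have hbd : ∀ m, N' ≤ m → ((m : ℝ) - η) * v m ≤ ((N' : ℝ) - η) * v N' := by
    intro m hm
    induction m, hm using Nat.le_induction with
    | base => exact le_rfl
    | succ m hm ih => exact (step m hm).trans ih
  obtain ⟨K, hK⟩ := exists_nat_gt ((((N' : ℝ) - η) * v N') / (ε / 2) + η)
  refine ⟨max N' K, fun m hm => ?_⟩
  have hm1 := le_trans (le_max_left _ _) hm
  have hmK : (K : ℝ) ≤ m := by exact_mod_cast le_trans (le_max_right _ _) hm
  have h1 := hbd m hm1
  have h2 : (((N' : ℝ) - η) * v N') / (ε / 2) < m - η := by linarith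
  rw [div_lt_iff₀ (by positivity)] at h2
  have h3 : v m < ε / 2 := lt_of_mul_lt_mul_left (h1.trans_lt h2) (hpos m hm1).le
  have h4 : |y m - β / c| - ε / 2 ≤ v m := le_max_left _ _
  rw [Real.dist_eq]
  linarith

theorem sizeProb_of_zero_mem (a η : ℝ) (n : ℕ) {ms : List ℕ} (h0 : 0 ∈ ms) :
    sizeProb a η n ms = 0 := by
  rw [sizeProb, expect_congr (G := fun _ => 0 * 1), expect_const_mul, zero_mul]
  intro T _
  rw [zero_mul, ind, if_neg]
  rintro rfl
  obtain ⟨t, -, ht⟩ := List.mem_map.1 h0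
  exact (size_pos t).ne' ht

theorem limProb_of_zero_mem (a η : ℝ) {A B : List ℕ} (h0 : 0 ∈ A ∨ 0 ∈ B) :
    limProb a η A B = 0 := by
  have : ∀ l : List ℕ, 0 ∈ l → (l.map (splitCoeff η)).prod = 0 := fun l hl =>
    List.prod_eq_zero (List.mem_map.2 ⟨0, hl, rfl⟩)
  rcases h0 with h0 | h0 <;> simp [limProb, this _ h0]

/-- As the size of the tree tends to infinity, the sizes of all but one of the subtrees remain
finite. -/
theorem Admissible.tendsto_sizeProb {a η : ℝ} {D : ℕ∞} (h : Admissible a η D) (A B : List ℕ) :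
    Tendsto (fun m => sizeProb a η (m + 1 + (A.sum + B.sum)) (A ++ m :: B)) atTop
      (𝓝 (limProb a η A B)) := by
  induction hM : A.sum + B.sum using Nat.strong_induction_on generalizing A B with
  | h M ih =>
  by_cases h0 : 0 ∈ A ∨ 0 ∈ B
  · rw [limProb_of_zero_mem a η h0]
    refine tendsto_const_nhds.congr fun m => ?_
    rw [sizeProb_of_zero_mem]
    simp only [List.mem_append, List.mem_cons]
    tauto
  have hA : ∀ m ∈ A, 1 ≤ m := fun m hm => Nat.one_le_iff_ne_zero.2 fun h' => h0 (Or.inl (h' ▸ hm))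
  have hB : ∀ m ∈ B, 1 ≤ m := fun m hm => Nat.one_le_iff_ne_zero.2 fun h' => h0 (Or.inr (h' ▸ hm))
  set β := limProb a η A B * ((M : ℝ) + 1) with hβ
  have hc : (0 : ℝ) < (M : ℝ) + 1 := by positivity
  have hβc : limProb a η A B = β / ((M : ℝ) + 1) := by rw [hβ]; field_simp
  rw [hβc]
  -- In the forward equation for target `A ++ (m + 1) :: B`, decreasing the distinguished entry
  -- gives the term `(m - η) * y m`; all other terms are collected in `b`.
  refine tendsto_of_recursion (c := (M : ℝ) + 1) (b := fun m =>
      a * ind (A ++ (m + 1) :: B) [m + 1 + M]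
      + (attachWeight a η (A.length + B.length)
        * (eraseSum (fun l => sizeProb a η (m + 1 + M) (l ++ (m + 1) :: B)) A
          + eraseSum (fun l => sizeProb a η (m + 1 + M) (A ++ (m + 1) :: l)) B)
      + (decSum η (fun l => sizeProb a η (m + 1 + M) (l ++ (m + 1) :: B)) A
          + decSum η (fun l => sizeProb a η (m + 1 + M) (A ++ (m + 1) :: l)) B)))
    h.eta_le (by linarith [(Nat.cast_nonneg M : (0 : ℝ) ≤ M)]) ?_ ?_
  · intro m hm
    have := h.sizeProb_succ (n := m + 1 + M) (by omega) (ms := A ++ (m + 1) :: B) (by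
      intro k hk
      simp only [List.mem_append, List.mem_cons] at hk
      rcases hk with hk | rfl | hk
      · exact hA k hk
      · omega
      · exact hB k hk)
    rw [eraseSum_append, decSum_append, if_neg (by omega), Nat.add_sub_cancel,
      show (A ++ (m + 1) :: B).length - 1 = A.length + B.length by simp,
      show m + 1 + M + 1 = m + 1 + 1 + M by omega] at this
    push_cast at this ⊢
    linear_combination this
  -- For `M = 0` only grafting onto the root edge contributes, and `b` is constantly `a`. Otherwise
  -- this source term vanishes and the predecessors, of total `M - 1`, converge by induction.
  · by_cases hM0 : M = 0
    · have hA0 : A = [] := by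
        rcases A with _ | ⟨k, A⟩
        · rfl
        · have := hA k (by simp)
          simp at hM; omega
      have hB0 : B = [] := by
        rcases B with _ | ⟨k, B⟩
        · rfl
        · have := hB k (by simp)
          simp at hM; omega
      subst hA0 hB0 hM0
      simp [hβ, limProb, ind, eraseSum, decSum, attachProd]
    · have hind : ∀ m, ind (A ++ (m + 1) :: B) [m + 1 + M] = 0 := by
        intro m
        refine if_neg fun heq => hM0 ?_
        have hl := congrArg List.length heq
        have hs := congrArg List.sum heq
        rcases A with _ | ⟨_, _⟩
        · rcases B with _ | ⟨_, _⟩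
          · simpa using hM.symm
          · simp at hl
        · simp at hl
      simp only [hind, mul_zero, zero_add]
      have hlim := limProb_eq a η hA hB (by omega)
      rw [hM, ← hβ] at hlim
      rw [← hlim]
      have hIH : ∀ A' B' : List ℕ, A'.sum + B'.sum + 1 = M → Tendsto (fun m =>
          sizeProb a η (m + 1 + M) (A' ++ (m + 1) :: B')) atTop (𝓝 (limProb a η A' B')) := by
        intro A' B' hAB
        have := (ih (A'.sum + B'.sum) (by omega) A' B' rfl).comp (tendsto_add_atTop_nat 1)
        refine this.congr fun m => ?_
        simp only [Function.comp]
        rw [show m + 1 + 1 + (A'.sum + B'.sum) = m + 1 + M by omega]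
      refine Tendsto.add (Tendsto.const_mul _ (Tendsto.add ?_ ?_)) (Tendsto.add ?_ ?_)
      · exact tendsto_eraseSum A fun l h1 _ => hIH l B (by omega)
      · exact tendsto_eraseSum B fun l h1 _ => hIH A l (by omega)
      · exact tendsto_decSum η hA fun l h1 _ => hIH l B (by omega)
      · exact tendsto_decSum η hB fun l h1 _ => hIH A l (by omega)

/-! ### Trees with prescribed outgrowths along a path from the root -/

/-- The trees planted at a vertex of the spine to the left and to the right of the spine. -/
abbrev Outgrowth : Type := List FTree × List FTree

namespace Outgrowth

/-- The total number of edges of an outgrowth. -/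
def size (o : Outgrowth) : ℕ := (o.1.map FTree.size).sum + (o.2.map FTree.size).sum

/-- The tree with neighbour of the root `v`, such that the tree `T` and the outgrowth `o` are
planted at `v`. -/
def graft (o : Outgrowth) (T : FTree) : FTree := node (o.1 ++ T :: o.2)

/-- Successive grafting of a list of outgrowths. -/
def graftList : List Outgrowth → FTree → FTree
  | [], T => T
  | o :: p, T => graft o (graftList p T)

theorem size_graft (o : Outgrowth) (T : FTree) : (graft o T).size = T.size + 1 + o.size := by
  simp only [graft, size_node, List.map_append, List.map_cons, List.sum_append, List.sum_cons, size]
  ring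

theorem size_le_size_graftList (p : List Outgrowth) (T : FTree) :
    T.size ≤ (graftList p T).size := by
  induction p with
  | nil => exact le_rfl
  | cons o p ih => rw [graftList, size_graft]; omega

theorem size_le_of_mem_left {o : Outgrowth} {T : FTree} (h : T ∈ o.1) : T.size ≤ o.size :=
  (List.le_sum_of_mem (List.mem_map_of_mem h)).trans (Nat.le_add_right _ _)

/-- If the two distinguished positions differed, one of the large trees would belong to the other
outgrowth, which is too small to contain it. -/
theorem graft_injective {o o' : Outgrowth} {T T' : FTree} (hT : o'.size < T.size)
    (hT' : o.size < T'.size) (h : graft o T = graft o' T') : o = o' ∧ T = T' := by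
  simp only [graft, node.injEq] at h
  obtain ⟨c, h1, h2⟩ | ⟨c, h1, h2⟩ := List.append_eq_append_iff.1 h
  · rcases c with _ | ⟨x, c⟩
    · simp only [List.append_nil, List.nil_append, List.cons.injEq] at h1 h2
      exact ⟨Prod.ext h1.symm h2.2, h2.1⟩
    · simp only [List.cons_append, List.cons.injEq] at h2
      have : T ∈ o'.1 := by rw [h1, h2.1]; simp
      exact absurd (size_le_of_mem_left this) (by omega)
  · rcases c with _ | ⟨x, c⟩
    · simp only [List.append_nil, List.nil_append, List.cons.injEq] at h1 h2
      exact ⟨Prod.ext h1 h2.2.symm, h2.1.symm⟩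
    · simp only [List.cons_append, List.cons.injEq] at h2
      have : T' ∈ o.1 := by rw [h1, h2.1]; simp
      exact absurd (size_le_of_mem_left this) (by omega)

theorem graftList_injective {K : ℕ} {p p' : List Outgrowth} {T T' : FTree}
    (hl : p.length = p'.length) (hp : ∀ o ∈ p, o.size ≤ K) (hp' : ∀ o ∈ p', o.size ≤ K)
    (hT : K < T.size) (hT' : K < T'.size) (h : graftList p T = graftList p' T') : p = p' := by
  induction p generalizing p' with
  | nil => exact (List.length_eq_zero_iff.1 hl.symm).symm
  | cons o p ih =>
    rcases p' with _ | ⟨o', p'⟩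
    · simp at hl
    · have h1 := size_le_size_graftList p T
      have h2 := size_le_size_graftList p' T'
      have h3 := hp o (by simp)
      have h4 := hp' o' (by simp)
      obtain ⟨rfl, h5⟩ := graft_injective (by omega) (by omega) h
      rw [ih (by simpa using hl) (fun x hx => hp x (by simp [hx]))
        (fun x hx => hp' x (by simp [hx])) h5]

end Outgrowth

/-- The product of the values of the functions in a list at the corresponding trees, and zero if
the lengths differ. -/
def prodEval : List (FTree → ℝ) → List FTree → ℝ
  | [], [] => 1
  | f :: fs, t :: ts => f t * prodEval fs ts
  | [], _ :: _ => 0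
  | _ :: _, [] => 0

open Classical in
/-- The indicator function of a tree. -/
def treeInd (t : FTree) : FTree → ℝ := fun s => if s = t then 1 else 0

/-- The probability of the tree `t` under the law of the growth process at the size of `t`. -/
def treeProb (a η : ℝ) (t : FTree) : ℝ := expect a η (size t) (treeInd t)

theorem expect_treeInd (a η : ℝ) (n : ℕ) (t : FTree) :
    expect a η n (treeInd t) = if n = size t then treeProb a η t else 0 := by
  split_ifs with h
  · rw [h, treeProb]
  · rw [expect_congr (G := fun _ => 0 * 1), expect_const_mul, zero_mul]
    intro s hs
    rw [zero_mul, treeInd, if_neg]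
    rintro rfl
    exact h hs.symm

theorem expectList_zero (a η : ℝ) (ns : List ℕ) : expectList a η ns (fun _ => 0) = 0 := by
  simpa using expectList_const_mul a η ns 0 fun _ => 0

theorem expectList_cons_mul (a η : ℝ) (n : ℕ) (ns : List ℕ) (f : FTree → ℝ)
    (Ψ : List FTree → ℝ) :
    expect a η n (fun t => expectList a η ns fun ts => f t * Ψ ts)
      = expect a η n f * expectList a η ns Ψ := by
  simp only [expectList_const_mul]
  exact lsum_mul_const _ _ _

theorem expect_zero (a η : ℝ) (n : ℕ) : expect a η n (fun _ => 0) = 0 := by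
  simpa using expect_const_mul a η n 0 fun _ => 0

theorem expectList_prodEval_treeInd (a η : ℝ) (ns : List ℕ) (ts : List FTree) :
    expectList a η ns (prodEval (ts.map treeInd))
      = ind (ts.map size) ns * (ts.map (treeProb a η)).prod := by
  induction ts generalizing ns with
  | nil =>
    cases ns with
    | nil => simp [expectList, prodEval, ind]
    | cons n ns => simp [expectList, prodEval, ind, expectList_zero, expect_zero]
  | cons t ts ih =>
    cases ns with
    | nil => simp [expectList, prodEval, ind]
    | cons n ns =>
      simp only [List.map_cons, expectList, prodEval, expectList_cons_mul, ih, ind_cons,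
        expect_treeInd, List.prod_cons]
      split_ifs
      · ring
      · simp

/-- Independence factorises the expectation. The condition on the total size forces the slot of `G`
to have size `m` once the other sizes are right. -/
theorem expectList_prodEval_graft (a η : ℝ) {m : ℕ} (L R : List FTree) (G : FTree → ℝ)
    (ns : List ℕ) (hns : ns.sum = (L.map size).sum + (R.map size).sum + m) :
    expectList a η ns (prodEval (L.map treeInd ++ G :: R.map treeInd))
      = ind (L.map size ++ m :: R.map size) ns
        * ((L.map (treeProb a η)).prod * (R.map (treeProb a η)).prod * expect a η m G) := by
  induction L generalizing ns with
  | nil =>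
    cases ns with
    | nil => simp [expectList, prodEval, ind]
    | cons n ns =>
      simp only [List.map_nil, List.nil_append, expectList, prodEval, expectList_cons_mul,
        expectList_prodEval_treeInd, ind_cons, List.prod_nil, one_mul]
      by_cases h : ns = R.map size
      · have : n = m := by
          simp only [List.sum_cons, h, List.map_nil, List.sum_nil] at hns
          omega
        subst this
        simp
        ring
      · simp [ind, h]
  | cons t L ih =>
    cases ns with
    | nil => simp [expectList, prodEval, ind]
    | cons n ns =>
      simp only [List.map_cons, List.cons_append, expectList, prodEval, expectList_cons_mul,
        expect_treeInd, ind_cons, List.prod_cons]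
      split_ifs with h
      · rw [ih ns (by simp only [List.map_cons, List.sum_cons, h] at hns; omega)]
        ring
      · simp

theorem prodEval_graft (L R : List FTree) (G : FTree → ℝ) (l : List FTree) :
    (∃ t, l = L ++ t :: R ∧ prodEval (L.map treeInd ++ G :: R.map treeInd) l = G t)
      ∨ prodEval (L.map treeInd ++ G :: R.map treeInd) l = 0 := by
  classical
  induction L generalizing l with
  | nil =>
    rcases l with _ | ⟨t, l⟩
    · exact Or.inr rfl
    · have : prodEval (R.map treeInd) l = if l = R then 1 else 0 := by
        clear t
        induction R generalizing l with
        | nil => cases l <;> simp [prodEval]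
        | cons r R ih =>
          cases l with
          | nil => simp [prodEval]
          | cons s l =>
            by_cases hs : s = r <;> simp [prodEval, ih, treeInd, hs]
      simp only [List.map_nil, List.nil_append, prodEval, this]
      by_cases h : l = R
      · exact Or.inl ⟨t, by simp [h]⟩
      · exact Or.inr (by simp [h])
  | cons s L ih =>
    rcases l with _ | ⟨t, l⟩
    · exact Or.inr rfl
    · simp only [List.map_cons, List.cons_append, prodEval]
      by_cases h : t = s
      · subst h
        rcases ih l with ⟨t', h1, h2⟩ | h1
        · exact Or.inl ⟨t', by rw [h1], by simp [treeInd, h2]⟩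
        · exact Or.inr (by simp [h1])
      · exact Or.inr (by simp [treeInd, h])

/-- The value `G T` at a tree `graft o T`, and zero at trees not of this form. -/
def graftEval (o : Outgrowth) (G : FTree → ℝ) (T : FTree) : ℝ :=
  prodEval (o.1.map treeInd ++ G :: o.2.map treeInd) T.subtrees

/-- The value `G T` at a tree `graftList p T`, and zero at trees not of this form. -/
def graftListEval : List Outgrowth → (FTree → ℝ) → FTree → ℝ
  | [], G => G
  | o :: p, G => graftEval o (graftListEval p G)

theorem graftListEval_eq (p : List Outgrowth) (G : FTree → ℝ) (T : FTree) :
    (∃ S, T = Outgrowth.graftList p S ∧ graftListEval p G T = G S)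
      ∨ graftListEval p G T = 0 := by
  induction p generalizing T with
  | nil => exact Or.inl ⟨T, rfl, rfl⟩
  | cons o p ih =>
    rcases prodEval_graft o.1 o.2 (graftListEval p G) T.subtrees with ⟨t, h1, h2⟩ | h1
    · rcases ih t with ⟨S, h3, h4⟩ | h3
      · refine Or.inl ⟨S, ?_, h2.trans h4⟩
        rw [Outgrowth.graftList, ← h3, Outgrowth.graft, ← h1, node_subtrees]
      · exact Or.inr (h2.trans h3)
    · exact Or.inr h1

/-- The law of the outgrowth at a vertex of the spine of the infinite tree. -/
def outgrowthProb (a η : ℝ) (o : Outgrowth) : ℝ :=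
  limProb a η (o.1.map size) (o.2.map size)
    * ((o.1.map (treeProb a η)).prod * (o.2.map (treeProb a η)).prod)

/-- The indicator function of the trees with more than `K` edges. -/
def largeInd (K : ℕ) (T : FTree) : ℝ := if K < size T then 1 else 0

namespace Admissible
variable {a η : ℝ} {D : ℕ∞} (h : Admissible a η D)
include h

theorem expect_graftEval (o : Outgrowth) (G : FTree → ℝ) {m : ℕ} (hm : 1 ≤ m) :
    expect a η (m + (1 + o.size)) (graftEval o G)
      = sizeProb a η (m + 1 + o.size) (o.1.map size ++ m :: o.2.map size)
        * ((o.1.map (treeProb a η)).prod * (o.2.map (treeProb a η)).prod) * expect a η m G := by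
  rw [← add_assoc, h.expect_eq_expectList (by omega), sizeProb, expect_congr (G := fun T =>
    (o.1.map (treeProb a η)).prod * (o.2.map (treeProb a η)).prod * expect a η m G
      * ind (o.1.map size ++ m :: o.2.map size) (T.subtrees.map size)), expect_const_mul]
  · ring
  · intro T hT
    rw [mul_comm, ← expectList_prodEval_graft]
    · rfl
    · rw [← node_subtrees T, size_node, Outgrowth.size] at hT
      omega

/-- Peel off the outgrowth nearest the root: by `expect_graftEval` the remaining tree follows the
growth law at a size smaller by `1 + o.size`, which still tends to infinity. Hence successive
outgrowths become independent. -/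
theorem tendsto_expect_graftListEval (p : List Outgrowth) (G : FTree → ℝ)
    (hG : Tendsto (fun n => expect a η n G) atTop (𝓝 1)) :
    Tendsto (fun n => expect a η n (graftListEval p G)) atTop
      (𝓝 (p.map (outgrowthProb a η)).prod) := by
  induction p with
  | nil => simpa [graftListEval] using hG
  | cons o p ih =>
    rw [← tendsto_add_atTop_iff_nat (1 + o.size), List.map_cons, List.prod_cons]
    have h1 := ((h.tendsto_sizeProb (o.1.map size) (o.2.map size)).mul_const
      ((o.1.map (treeProb a η)).prod * (o.2.map (treeProb a η)).prod)).mul ih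
    refine h1.congr' ?_
    filter_upwards [eventually_ge_atTop 1] with m hm
    exact (h.expect_graftEval o _ hm).symm

theorem tendsto_expect_largeInd (K : ℕ) :
    Tendsto (fun n => expect a η n (largeInd K)) atTop (𝓝 1) := by
  refine tendsto_const_nhds.congr' ?_
  filter_upwards [eventually_gt_atTop K] with n hn
  rw [expect_congr (G := fun _ => 1), h.expect_one (by omega)]
  intro T hT
  simp [largeInd, hT, hn]

/-- The asymptotic probability of a set of trees that contains all trees with certain
outgrowths. -/
theorem exists_tendsto_le_expect {F : Finset (List Outgrowth)} {k : ℕ}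
    (hF : ∀ p ∈ F, p.length = k) {S : Set FTree}
    (hS : ∀ p ∈ F, ∀ T, Outgrowth.graftList p T ∈ S) :
    ∃ f : ℕ → ℝ, Tendsto f atTop (𝓝 (∑ p ∈ F, (p.map (outgrowthProb a η)).prod)) ∧
      ∀ n, f n ≤ expect a η n (S.indicator 1) := by
  obtain ⟨K, hK⟩ : ∃ K, ∀ p ∈ F, ∀ o ∈ p, Outgrowth.size o ≤ K := by
    refine ⟨F.sup fun p => (p.map Outgrowth.size).sum, fun p hp o ho => ?_⟩
    exact (List.le_sum_of_mem (List.mem_map_of_mem ho)).trans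
      (Finset.le_sup (f := fun p : List Outgrowth => (p.map Outgrowth.size).sum) hp)
  -- Requiring more than `K` edges beyond the prescribed outgrowths makes the events for different
  -- `p` disjoint, by `graftList_injective`, at no asymptotic cost.
  refine ⟨fun n => ∑ p ∈ F, expect a η n (graftListEval p (largeInd K)),
    tendsto_finsetSum _ fun p _ => h.tendsto_expect_graftListEval p _ (h.tendsto_expect_largeInd K),
    fun n => ?_⟩
  dsimp only
  simp only [expect]
  rw [← lsum_finset_sum]
  refine h.expect_mono fun T _ => ?_
  by_cases h0 : ∃ p ∈ F, graftListEval p (largeInd K) T ≠ 0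
  · obtain ⟨p, hp, hpT⟩ := h0
    obtain ⟨S₁, h1, h2⟩ := (graftListEval_eq p (largeInd K) T).resolve_right hpT
    have hS₁ : K < size S₁ := by
      by_contra hlt
      exact hpT (by rw [h2, largeInd, if_neg hlt])
    rw [Finset.sum_eq_single p _ (fun hp' => absurd hp hp'), h2, Set.indicator_of_mem]
    · simp [largeInd, hS₁]
    · rw [h1]; exact hS p hp S₁
    · intro q hq hqp
      by_contra hqT
      obtain ⟨S₂, h3, h4⟩ := (graftListEval_eq q (largeInd K) T).resolve_right hqT
      have hS₂ : K < size S₂ := by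
        by_contra hlt
        exact hqT (by rw [h4, largeInd, if_neg hlt])
      exact hqp (Outgrowth.graftList_injective ((hF q hq).trans (hF p hp).symm) (hK q hq) (hK p hp)
        hS₂ hS₁ (h3.symm.trans h1))
  · push Not at h0
    rw [Finset.sum_eq_zero h0]
    exact Set.indicator_nonneg (fun _ _ => zero_le_one) _

end Admissible

instance : Countable FTree := by
  have key : ∀ n, {T : FTree | size T ≤ n}.Countable := by
    intro n
    induction n with
    | zero =>
      convert Set.countable_empty
      ext T
      simpa using (size_pos T).ne'
    | succ n ih =>
      have : Countable {T : FTree | size T ≤ n} := ih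
      refine (Set.countable_range fun l : List {T : FTree | size T ≤ n} =>
        node (l.map Subtype.val)).mono ?_
      rintro ⟨l⟩ hl
      have hl' : ∀ t ∈ l, t ∈ {T : FTree | size T ≤ n} := by
        intro t ht
        have h1 := List.le_sum_of_mem (List.mem_map_of_mem (f := size) ht)
        simp only [Set.mem_ofPred_eq, size_node] at hl ⊢
        omega
      lift l to List {T : FTree | size T ≤ n} using hl'
      exact ⟨l, rfl⟩
  rw [← Set.countable_univ_iff]
  refine (Set.countable_iUnion key).mono fun T _ => ?_
  exact Set.mem_iUnion.2 ⟨size T, le_refl (size T)⟩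

/-! ### Sums over lists -/

section tsum
open scoped ENNReal
variable {X : Type*} (u : X → ℝ≥0∞)

theorem tsum_list_of_length (n : ℕ) :
    ∑' L : List X, (if L.length = n then (L.map u).prod else 0) = (∑' x, u x) ^ n := by
  induction n with
  | zero =>
    rw [tsum_eq_single []]
    · simp
    · intro L hL
      simp [hL]
  | succ n ih =>
    have hinj : Function.Injective fun q : X × List X => q.1 :: q.2 := by
      rintro ⟨x, l⟩ ⟨y, m⟩ h
      simpa using h
    rw [← hinj.tsum_eq, ENNReal.tsum_prod', pow_succ', ← ENNReal.tsum_mul_right]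
    · congr with x
      rw [← ih, ← ENNReal.tsum_mul_left]
      congr with L
      simp
    · rintro (_ | ⟨x, L⟩) hL
      · simp at hL
      · exact ⟨(x, L), rfl⟩

theorem tsum_list (f : ℕ → ℝ≥0∞) :
    ∑' L : List X, f L.length * (L.map u).prod = ∑' n, f n * (∑' x, u x) ^ n := by
  have : ∀ L : List X, f L.length * (L.map u).prod
      = ∑' n, f n * (if L.length = n then (L.map u).prod else 0) := by
    intro L
    rw [tsum_eq_single L.length]
    · simp
    · intro n hn
      simp [hn.symm]
  simp only [this]
  rw [ENNReal.tsum_comm]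
  simp only [ENNReal.tsum_mul_left, tsum_list_of_length]

/-- The factor `n + 1` counts the ways of dividing `n` trees into those left and those right of the
spine. -/
theorem tsum_list_prod (f : ℕ → ℝ≥0∞) :
    ∑' o : List X × List X, f (o.1.length + o.2.length) * ((o.1.map u).prod * (o.2.map u).prod)
      = ∑' n : ℕ, ((n : ℝ≥0∞) + 1) * f n * (∑' x, u x) ^ n := by
  set U := ∑' x, u x
  calc _ = ∑' L : List X, (∑' m, f (L.length + m) * U ^ m) * (L.map u).prod := by
        rw [ENNReal.tsum_prod']
        congr with L
        rw [← tsum_list u fun m => f (L.length + m), ← ENNReal.tsum_mul_right]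
        congr with R
        ring
    _ = ∑' q : ℕ × ℕ, f (q.1 + q.2) * U ^ (q.1 + q.2) := by
        rw [tsum_list u fun n => ∑' m, f (n + m) * U ^ m, ENNReal.tsum_prod']
        congr with n
        rw [← ENNReal.tsum_mul_right]
        congr with m
        rw [pow_add]
        ring
    _ = _ := by
        rw [← Finset.HasAntidiagonal.sigmaAntidiagonalEquivProd.tsum_eq, ENNReal.tsum_sigma']
        congr with n
        rw [tsum_fintype, Finset.sum_congr rfl (g := fun _ => f n * U ^ n)]
        · simp
          ring
        · rintro ⟨q, hq⟩ -
          have hq' := Finset.HasAntidiagonal.mem_antidiagonal.1 hq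
          simp [Finset.HasAntidiagonal.sigmaAntidiagonalEquivProd, hq']

/-- Source of the integral in the theorem: it represents the factor `1 / (M + 1)` of `limProb`,
after which the weights are multiplicative over the trees of an outgrowth. -/
theorem lintegral_pow (M : ℕ) :
    ∫⁻ ζ in Set.Ioo (0 : ℝ) 1, ENNReal.ofReal ζ ^ M = ENNReal.ofReal (1 / ((M : ℝ) + 1)) := by
  have h1 : ∫ ζ in Set.Ioo (0 : ℝ) 1, ζ ^ M = 1 / ((M : ℝ) + 1) := by
    rw [← integral_Ioc_eq_integral_Ioo, ← intervalIntegral.integral_of_le zero_le_one,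
      integral_pow]
    simp
  rw [← h1, ofReal_integral_eq_lintegral_ofReal]
  · refine setLIntegral_congr_fun measurableSet_Ioo fun ζ hζ => ?_
    rw [ENNReal.ofReal_pow hζ.1.le]
  · exact ((continuous_pow M).integrableOn_Icc (μ := volume)).mono_set Set.Ioo_subset_Icc_self
  · filter_upwards [self_mem_ae_restrict measurableSet_Ioo] with ζ hζ
    exact pow_nonneg hζ.1.le M

end tsum

/-! ### Binomial series -/

theorem hasSum_ascPochhammer (β : ℝ) {x : ℝ} (hx : |x| < 1) :
    HasSum (fun n : ℕ => (ascPochhammer ℝ n).eval β / n.factorial * x ^ n) ((1 - x) ^ (-β)) := by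
  have h := (Real.one_div_one_sub_rpow_hasFPowerSeriesOnBall_zero β).hasSum (y := x)
    (by simpa [enorm_eq_nnnorm] using! hx)
  have hx' : 0 ≤ 1 - x := by have := (abs_lt.1 hx).2; linarith
  rw [zero_add, one_div, ← Real.rpow_neg hx'] at h
  have hn : ∀ n : ℕ, Ring.choose (β + n - 1) n = (ascPochhammer ℝ n).eval β / n.factorial := by
    intro n
    rw [Ring.choose_eq_smul, Polynomial.descPochhammer_smeval_eq_ascPochhammer,
      Polynomial.ascPochhammer_smeval_eq_eval, smul_eq_mul, div_eq_inv_mul]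
    ring_nf
  simpa [hn, mul_comm] using h

theorem gammaFactor_succ (η : ℝ) (n : ℕ) :
    gammaFactor η (n + 1) = -η * splitCoeff η (n + 1) := by
  induction n with
  | zero => simp [gammaFactor, splitCoeff]
  | succ n ih =>
    rw [gammaFactor] at ih ⊢
    rw [splitCoeff, ascPochhammer_succ_eval, Nat.factorial_succ]
    have : ((n + 1).factorial : ℝ) ≠ 0 := by positivity
    rw [div_eq_iff this] at ih
    rw [ih]
    push_cast
    field_simp
    ring

theorem splitCoeff_nonneg {η : ℝ} (hη : η ≤ 1) (m : ℕ) : 0 ≤ splitCoeff η m := by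
  induction m using splitCoeff.induct with
  | case1 => exact le_rfl
  | case2 => exact zero_le_one
  | case3 m ih =>
    rw [splitCoeff]
    have : (0 : ℝ) ≤ (m : ℝ) + 1 - η := by linarith [(Nat.cast_nonneg m : (0 : ℝ) ≤ m)]
    positivity

theorem splitCoeff_zero_le (m : ℕ) : splitCoeff 0 m ≤ 1 := by
  induction m using splitCoeff.induct with
  | case1 => exact zero_le_one
  | case2 => exact le_rfl
  | case3 m ih =>
    rw [splitCoeff]
    have h1 : ((m : ℝ) + 1 - 0) / ((m : ℝ) + 2) ≤ 1 := by
      rw [div_le_one (by positivity)]; linarith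
    exact mul_le_one₀ h1 (splitCoeff_nonneg zero_le_one _) ih

theorem hasSum_gammaFactor (η : ℝ) {ζ : ℝ} (h0 : 0 ≤ ζ) (h1 : ζ < 1) :
    HasSum (fun n => gammaFactor η n * ζ ^ n) ((1 - ζ) ^ η) := by
  simpa [gammaFactor] using hasSum_ascPochhammer (-η) (x := ζ) (by rwa [abs_of_nonneg h0])

/-- For `η ≠ 0` divide the binomial series by `-η`; for `η = 0` that information is lost and a
geometric series dominates instead. -/
theorem summable_splitCoeff {η : ℝ} (hη : η ≤ 1) {ζ : ℝ} (h0 : 0 ≤ ζ) (h1 : ζ < 1) :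
    Summable fun n => splitCoeff η n * ζ ^ n := by
  by_cases hη0 : η = 0
  · subst hη0
    refine Summable.of_nonneg_of_le
      (fun n => mul_nonneg (splitCoeff_nonneg hη n) (pow_nonneg h0 n)) (fun n => ?_)
      (summable_geometric_of_lt_one h0 h1)
    exact mul_le_of_le_one_left (pow_nonneg h0 n) (splitCoeff_zero_le n)
  · have h := ((summable_nat_add_iff 1).2 (hasSum_gammaFactor η h0 h1).summable).mul_left (-η)⁻¹
    rw [← summable_nat_add_iff 1]
    refine h.congr fun n => ?_
    rw [gammaFactor_succ]
    field_simp

-- The generating function of the attachment weights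

namespace Admissible
variable {a η : ℝ} {D : ℕ∞} (h : Admissible a η D)
include h

/-- A spine vertex carrying `s` trees has degree `s + 2`. The factor for attaching at degree `D` is
zero, so later factors, possibly negative, do not matter. -/
theorem attachProd_nonneg_and (s : ℕ) :
    0 ≤ attachProd a η s ∧ (D ≤ ((s + 1 : ℕ) : ℕ∞) → attachProd a η s = 0) := by
  induction s with
  | zero =>
    refine ⟨zero_le_one, fun hD => absurd (h.three_le.trans hD) ?_⟩
    norm_num
  | succ s ih =>
    rw [attachProd]
    by_cases hD : D ≤ ((s + 1 : ℕ) : ℕ∞)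
    · simp [ih.2 hD]
    · have hD' : ((s + 1 + 1 : ℕ) : ℕ∞) ≤ D := by
        push_cast at hD ⊢
        exact Order.add_one_le_of_lt (not_le.1 hD)
      refine ⟨mul_nonneg ih.1 ?_, fun hD2 => ?_⟩
      · have := h.weight_nonneg (s + 1 + 1) (by omega) hD'
        rw [attachWeight]
        push_cast at this ⊢
        positivity
      · have := h.weight_eq_zero (s + 1 + 1) (le_antisymm hD' hD2)
        rw [attachWeight]
        push_cast at this ⊢
        rw [this]
        simp

theorem attachProd_nonneg (s : ℕ) : 0 ≤ attachProd a η s := (h.attachProd_nonneg_and s).1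

theorem eta_mul {d : ℕ} (hd : D = d) : η * ((d - 2 : ℕ) : ℝ) = a - 1 := by
  have h3 : 3 ≤ d := by
    have := h.three_le
    rw [hd] at this
    exact_mod_cast this
  have := h.weight_eq_zero d hd.symm
  rw [Nat.cast_sub (by omega)]
  push_cast
  linarith

/-- The coefficients `(n + 1) * attachProd a η n` have successive ratios `(η n + 1 - a) / (n + 1)`,
those of a binomial series. For `η < 0` the exponent is the integer `D - 2` and the series
terminates, so `x` need not be small; for `η = 0` necessarily `a = 1` and only the constant term
survives. -/
theorem hasSum_attachProd {x : ℝ} (hx : 0 ≤ x) (hx1 : η * x < 1) :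
    HasSum (fun n : ℕ => ((n : ℝ) + 1) * attachProd a η n * x ^ n)
      ((1 - η * x) ^ ((a - 1) / η)) := by
  have hrec : ∀ n : ℕ, (((n + 1 : ℕ) : ℝ) + 1) * attachProd a η (n + 1) * ((n : ℝ) + 1)
      = (((n : ℝ) + 1) * attachProd a η n) * (η * n + 1 - a) := by
    intro n
    rw [attachProd, attachWeight]
    push_cast
    field_simp
    ring
  rcases lt_trichotomy η 0 with hη | hη | hη
  · obtain ⟨d, hd⟩ : ∃ d : ℕ, D = d := by
      rcases eq_or_ne D ⊤ with hD | hD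
      · exact absurd (h.eta_pos hD) (by linarith)
      · exact ⟨D.toNat, (ENat.natCast_toNat hD).symm⟩
    have hd' := h.eta_mul hd
    set e := d - 2
    have hc : ∀ n : ℕ, ((n : ℝ) + 1) * attachProd a η n = (e.choose n : ℝ) * (-η) ^ n := by
      intro n
      induction n with
      | zero => simp [attachProd]
      | succ n ih =>
        have h1 := hrec n
        rw [ih] at h1
        have h2 : (e.choose (n + 1) : ℝ) * ((n : ℝ) + 1) = e.choose n * ((e : ℝ) - n) := by
          rcases le_or_gt n e with hne | hne
          · have := Nat.choose_succ_right_eq e n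
            rw [← Nat.cast_sub hne]
            exact_mod_cast this
          · simp [Nat.choose_eq_zero_of_lt hne, Nat.choose_eq_zero_of_lt (hne.trans (Nat.lt_succ_self n))]
        have h3 : (n : ℝ) + 1 ≠ 0 := by positivity
        refine mul_right_cancel₀ h3 (h1.trans ?_)
        rw [pow_succ]
        linear_combination (-η) ^ n * η * h2 + (e.choose n : ℝ) * (-η) ^ n * hd'
    have he : (a - 1) / η = e := by rw [← hd', mul_div_cancel_left₀ _ hη.ne]
    rw [he, Real.rpow_natCast, show 1 - η * x = -η * x + 1 by ring, add_pow]
    simp only [hc]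
    rw [Finset.sum_congr rfl (g := fun n : ℕ => (e.choose n : ℝ) * (-η) ^ n * x ^ n)
      fun n _ => by rw [mul_pow]; ring]
    refine hasSum_sum_of_ne_finset_zero fun n hn => ?_
    rw [Nat.choose_eq_zero_of_lt (by simpa using hn)]
    simp
  · have ha : a = 1 := by
      obtain ⟨d, hd⟩ : ∃ d : ℕ, D = d := by
        rcases eq_or_ne D ⊤ with hD | hD
        · exact absurd (h.eta_pos hD) (by linarith)
        · exact ⟨D.toNat, (ENat.natCast_toNat hD).symm⟩
      have := h.eta_mul hd
      rw [hη] at this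
      linarith
    subst hη ha
    have hc : ∀ n : ℕ, n ≠ 0 → attachProd 1 0 n = 0 := by
      intro n hn
      obtain ⟨n, rfl⟩ := Nat.exists_eq_succ_of_ne_zero hn
      simp [attachProd, attachWeight]
    convert hasSum_single (0 : ℕ) fun n hn => ?_ using 1
    · simp [attachProd]
    · simp [hc n hn]
  · have hc : ∀ n : ℕ, ((n : ℝ) + 1) * attachProd a η n
        = (ascPochhammer ℝ n).eval ((1 - a) / η) / n.factorial * η ^ n := by
      intro n
      induction n with
      | zero => simp [attachProd]
      | succ n ih =>
        have h1 := hrec n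
        rw [ih] at h1
        have h3 : (n : ℝ) + 1 ≠ 0 := by positivity
        refine mul_right_cancel₀ h3 (h1.trans ?_)
        have : (n.factorial : ℝ) ≠ 0 := by positivity
        rw [ascPochhammer_succ_eval, Nat.factorial_succ]
        push_cast
        field_simp
        ring
    have := hasSum_ascPochhammer ((1 - a) / η) (x := η * x)
      (by rwa [abs_of_nonneg (by positivity)])
    rw [show (a - 1) / η = -((1 - a) / η) by ring]
    convert this using 2 with n
    rw [hc, mul_pow]
    ring

end Admissible

/-! ### The generating function of the outgrowths -/

open scoped ENNReal

/-- The probability of the set `S` of trees under the law of the growth process at size `n`. -/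
def setProb (a η : ℝ) (S : Set FTree) (n : ℕ) : ℝ := expect a η n (S.indicator 1)

/-- The generating function of the weights of the trees in `S`. -/
def genG (a η : ℝ) (S : Set FTree) (ζ : ℝ) : ℝ :=
  ∑' n : ℕ, splitCoeff η n * setProb a η S n * ζ ^ n

/-- The weight with which the tree `t` contributes to an outgrowth with trees in `S`. -/
def treeWeight (a η : ℝ) (S : Set FTree) : FTree → ℝ≥0∞ :=
  S.indicator fun t => ENNReal.ofReal (splitCoeff η (size t) * treeProb a η t)

/-- The outgrowths all of whose trees belong to `S`. -/
def Outgrowth.inSet (S : Set FTree) : Set Outgrowth :=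
  {o | (∀ t ∈ o.1, t ∈ S) ∧ ∀ t ∈ o.2, t ∈ S}

namespace Admissible
variable {a η : ℝ} {D : ℕ∞} (h : Admissible a η D)
include h

theorem setProb_nonneg (S : Set FTree) (n : ℕ) : 0 ≤ setProb a η S n :=
  h.expect_nonneg fun _ => Set.indicator_nonneg (fun _ _ => zero_le_one) _

theorem setProb_univ {n : ℕ} (hn : 1 ≤ n) : setProb a η Set.univ n = 1 := by
  simpa [setProb, Pi.one_def] using h.expect_one hn

theorem setProb_mono {S S' : Set FTree} (hS : S ⊆ S') (n : ℕ) :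
    setProb a η S n ≤ setProb a η S' n :=
  h.expect_mono fun _ _ => Set.indicator_le_indicator_of_subset hS (fun _ => zero_le_one) _

theorem setProb_le_one (S : Set FTree) (n : ℕ) : setProb a η S n ≤ 1 := by
  rcases Nat.eq_zero_or_pos n with rfl | hn
  · simp [setProb, expect, growthLaw]
  · exact (h.setProb_mono (Set.subset_univ S) n).trans_eq (h.setProb_univ hn)

theorem treeProb_nonneg (t : FTree) : 0 ≤ treeProb a η t := by
  classical
  exact h.expect_nonneg fun s => by rw [treeInd]; split_ifs <;> simp

theorem summable_genG (S : Set FTree) {ζ : ℝ} (h0 : 0 ≤ ζ) (h1 : ζ < 1) :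
    Summable fun n : ℕ => splitCoeff η n * setProb a η S n * ζ ^ n := by
  refine Summable.of_nonneg_of_le (fun n => ?_) (fun n => ?_) (summable_splitCoeff h.eta_le h0 h1)
  · exact mul_nonneg (mul_nonneg (splitCoeff_nonneg h.eta_le n) (h.setProb_nonneg S n))
      (pow_nonneg h0 n)
  · exact mul_le_mul_of_nonneg_right (mul_le_of_le_one_right (splitCoeff_nonneg h.eta_le n)
      (h.setProb_le_one S n)) (pow_nonneg h0 n)

/-- Apart from the constant term, fixed by the convention `Q 0 = 1`, `gammaFactor` is `-η` times
`splitCoeff`; this identifies `H_R` with `1 - η G`. -/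
theorem hasSum_gammaFactor_mul (S : Set FTree) {Q : ℕ → ℝ} (hQ0 : Q 0 = 1)
    (hQ : ∀ n, 1 ≤ n → Q n = setProb a η S n) {ζ : ℝ} (h0 : 0 ≤ ζ) (h1 : ζ < 1) :
    HasSum (fun n => gammaFactor η n * Q n * ζ ^ n) (1 - η * genG a η S ζ) := by
  have := (hasSum_ite_eq (0 : ℕ) (1 : ℝ)).add ((h.summable_genG S h0 h1).hasSum.mul_left (-η))
  rw [← genG, neg_mul, ← sub_eq_add_neg] at this
  convert this using 2 with n
  rcases n with _ | n
  · simp [hQ0, gammaFactor, splitCoeff]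
  · simp only [hQ (n + 1) (by omega), gammaFactor_succ, Nat.add_eq_zero_iff, one_ne_zero, and_false,
      if_false]
    ring

theorem one_sub_genG_univ {ζ : ℝ} (h0 : 0 ≤ ζ) (h1 : ζ < 1) :
    1 - η * genG a η Set.univ ζ = (1 - ζ) ^ η := by
  refine (h.hasSum_gammaFactor_mul Set.univ (Q := fun _ => 1) rfl
    (fun n hn => (h.setProb_univ hn).symm) h0 h1).unique ?_
  simpa using hasSum_gammaFactor η h0 h1

theorem genG_nonneg (S : Set FTree) {ζ : ℝ} (h0 : 0 ≤ ζ) : 0 ≤ genG a η S ζ :=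
  tsum_nonneg fun n => mul_nonneg
    (mul_nonneg (splitCoeff_nonneg h.eta_le n) (h.setProb_nonneg S n)) (pow_nonneg h0 n)

/-- For `η > 0` compare with the set of all trees, where `1 - η G = (1 - ζ) ^ η` is positive. -/
theorem genG_lt (S : Set FTree) {ζ : ℝ} (h0 : 0 ≤ ζ) (h1 : ζ < 1) : η * genG a η S ζ < 1 := by
  rcases le_or_gt η 0 with hη | hη
  · exact (mul_nonpos_of_nonpos_of_nonneg hη (h.genG_nonneg S h0)).trans_lt one_pos
  · have h2 : genG a η S ζ ≤ genG a η Set.univ ζ := by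
      refine (h.summable_genG S h0 h1).tsum_le_tsum (fun n => ?_) (h.summable_genG _ h0 h1)
      exact mul_le_mul_of_nonneg_right (mul_le_mul_of_nonneg_left
        (h.setProb_mono (Set.subset_univ S) n) (splitCoeff_nonneg h.eta_le n)) (pow_nonneg h0 n)
    have h3 := h.one_sub_genG_univ h0 h1
    have h4 : 0 < (1 - ζ) ^ η := Real.rpow_pos_of_pos (by linarith) η
    nlinarith [mul_le_mul_of_nonneg_left h2 hη.le]

theorem tsum_treeWeight (S : Set FTree) {ζ : ℝ} (h0 : 0 ≤ ζ) (h1 : ζ < 1) :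
    ∑' t, treeWeight a η S t * ENNReal.ofReal ζ ^ size t = ENNReal.ofReal (genG a η S ζ) := by
  classical
  have hS : ∀ n, ENNReal.ofReal (setProb a η S n)
      = ∑' t, ENNReal.ofReal (expect a η n (treeInd t) * S.indicator 1 t) := by
    intro n
    have hs := hasSum_lsum (growthLaw a η n) (S.indicator 1)
    have e : (fun t => lsum (growthLaw a η n) (fun y => if y = t then 1 else 0) * S.indicator 1 t)
        = fun t => expect a η n (treeInd t) * S.indicator 1 t := by
      funext t
      rw [expect]
      congr 2
    rw [e] at hs
    rw [setProb, expect, ← hs.tsum_eq]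
    refine ENNReal.ofReal_tsum_of_nonneg (fun t => mul_nonneg (h.expect_nonneg fun s => ?_)
      (Set.indicator_nonneg (fun _ _ => zero_le_one) _)) hs.summable
    rw [treeInd]
    split_ifs <;> simp
  rw [genG, ENNReal.ofReal_tsum_of_nonneg _ (h.summable_genG S h0 h1)]
  · have : ∀ n, ENNReal.ofReal (splitCoeff η n * setProb a η S n * ζ ^ n)
        = ∑' t, ENNReal.ofReal (splitCoeff η n) * ENNReal.ofReal ζ ^ n
          * ENNReal.ofReal (expect a η n (treeInd t) * S.indicator 1 t) := by
      intro n
      rw [ENNReal.tsum_mul_left, ← hS, mul_right_comm,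
        ENNReal.ofReal_mul (mul_nonneg (splitCoeff_nonneg h.eta_le n) (pow_nonneg h0 n)),
        ENNReal.ofReal_mul (splitCoeff_nonneg h.eta_le n), ENNReal.ofReal_pow h0]
    simp only [this]
    rw [ENNReal.tsum_comm]
    congr with t
    rw [tsum_eq_single (size t)]
    · by_cases ht : t ∈ S
      · simp only [treeWeight, Set.indicator_of_mem ht, Pi.one_apply, mul_one, treeProb]
        rw [ENNReal.ofReal_mul (splitCoeff_nonneg h.eta_le _)]
        ring
      · simp [treeWeight, ht]
    · intro n hn
      simp [expect_treeInd, hn]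
  · intro n
    exact mul_nonneg (mul_nonneg (splitCoeff_nonneg h.eta_le n) (h.setProb_nonneg S n))
      (pow_nonneg h0 n)

end Admissible

theorem prod_treeWeight_mul_pow (a η : ℝ) (S : Set FTree) (x : ℝ≥0∞) (l : List FTree) :
    (l.map fun t => treeWeight a η S t * x ^ size t).prod
      = (l.map (treeWeight a η S)).prod * x ^ (l.map size).sum := by
  induction l with
  | nil => simp
  | cons t l ih =>
    simp only [List.map_cons, List.prod_cons, ih, List.sum_cons, pow_add]
    ring

theorem prod_treeWeight_eq_zero (a η : ℝ) (S : Set FTree) {l : List FTree}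
    (hl : ¬ ∀ t ∈ l, t ∈ S) : (l.map (treeWeight a η S)).prod = 0 := by
  push Not at hl
  obtain ⟨t, ht, htS⟩ := hl
  refine List.prod_eq_zero (List.mem_map.2 ⟨t, ht, ?_⟩)
  simp [treeWeight, htS]

theorem list_prod_nonneg {β : Type*} {f : β → ℝ} (hf : ∀ x, 0 ≤ f x) (l : List β) :
    0 ≤ (l.map f).prod := by
  refine List.prod_nonneg fun x hx => ?_
  obtain ⟨y, -, rfl⟩ := List.mem_map.1 hx
  exact hf y

namespace Admissible
variable {a η : ℝ} {D : ℕ∞} (h : Admissible a η D)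
include h

theorem prod_treeWeight (S : Set FTree) {l : List FTree} (hl : ∀ t ∈ l, t ∈ S) :
    (l.map (treeWeight a η S)).prod
      = ENNReal.ofReal (((l.map size).map (splitCoeff η)).prod * (l.map (treeProb a η)).prod) := by
  induction l with
  | nil => simp
  | cons t l ih =>
    simp only [List.mem_cons, forall_eq_or_imp] at hl
    simp only [List.map_cons, List.prod_cons, ih hl.2]
    rw [treeWeight, Set.indicator_of_mem hl.1,
      ← ENNReal.ofReal_mul (mul_nonneg (splitCoeff_nonneg h.eta_le _) (h.treeProb_nonneg t))]
    congr 1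
    ring

theorem outgrowthProb_nonneg (o : Outgrowth) : 0 ≤ outgrowthProb a η o := by
  have h1 := h.pos.le
  have h2 := h.attachProd_nonneg
  have h3 := list_prod_nonneg (splitCoeff_nonneg h.eta_le)
  have h4 := list_prod_nonneg h.treeProb_nonneg
  rw [outgrowthProb, limProb]
  exact mul_nonneg (mul_nonneg (mul_nonneg (mul_nonneg (by positivity) (h2 _)) (h3 _)) (h3 _))
    (mul_nonneg (h4 _) (h4 _))

theorem lintegral_outgrowth (S : Set FTree) (o : Outgrowth) :
    ∫⁻ ζ in Set.Ioo (0 : ℝ) 1, ENNReal.ofReal a * (ENNReal.ofReal (attachProd a η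
        (o.1.length + o.2.length))
        * ((o.1.map fun t => treeWeight a η S t * ENNReal.ofReal ζ ^ size t).prod
          * (o.2.map fun t => treeWeight a η S t * ENNReal.ofReal ζ ^ size t).prod))
      = (Outgrowth.inSet S).indicator (fun o => ENNReal.ofReal (outgrowthProb a η o)) o := by
  simp only [prod_treeWeight_mul_pow]
  have e : ∀ ζ : ℝ, ENNReal.ofReal a * (ENNReal.ofReal (attachProd a η (o.1.length + o.2.length))
      * ((o.1.map (treeWeight a η S)).prod * ENNReal.ofReal ζ ^ (o.1.map size).sum
        * ((o.2.map (treeWeight a η S)).prod * ENNReal.ofReal ζ ^ (o.2.map size).sum)))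
      = ENNReal.ofReal a * (ENNReal.ofReal (attachProd a η (o.1.length + o.2.length))
        * ((o.1.map (treeWeight a η S)).prod * (o.2.map (treeWeight a η S)).prod))
        * ENNReal.ofReal ζ ^ o.size := by
    intro ζ
    rw [Outgrowth.size, pow_add]
    ring
  simp only [e]
  rw [lintegral_const_mul _ (by fun_prop), lintegral_pow]
  by_cases ho : o ∈ Outgrowth.inSet S
  · have h2 := h.attachProd_nonneg (o.1.length + o.2.length)
    have h3 := list_prod_nonneg (splitCoeff_nonneg h.eta_le)
    have h4 := list_prod_nonneg h.treeProb_nonneg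
    have h5 := mul_nonneg (h3 (o.1.map size)) (h4 o.1)
    have h6 := mul_nonneg (h3 (o.2.map size)) (h4 o.2)
    rw [Set.indicator_of_mem ho, h.prod_treeWeight S ho.1, h.prod_treeWeight S ho.2,
      ← ENNReal.ofReal_mul h5, ← ENNReal.ofReal_mul h2, ← ENNReal.ofReal_mul h.pos.le,
      ← ENNReal.ofReal_mul (mul_nonneg h.pos.le (mul_nonneg h2 (mul_nonneg h5 h6)))]
    congr 1
    rw [outgrowthProb, limProb, Outgrowth.size, List.length_map, List.length_map]
    ring
  · rw [Set.indicator_of_notMem ho]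
    have : (o.1.map (treeWeight a η S)).prod * (o.2.map (treeWeight a η S)).prod = 0 := by
      by_cases h1 : ∀ t ∈ o.1, t ∈ S
      · rw [prod_treeWeight_eq_zero a η S fun h2 => ho ⟨h1, h2⟩, mul_zero]
      · rw [prod_treeWeight_eq_zero a η S h1, zero_mul]
    simp [this]

/-- Tonelli exchanges sum and integral. For fixed `ζ`, summing over the trees gives powers of
`genG`, and summing over their number gives `hasSum_attachProd`. -/
theorem tsum_outgrowthProb (S : Set FTree) :
    ∑' o, (Outgrowth.inSet S).indicator (fun o => ENNReal.ofReal (outgrowthProb a η o)) o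
      = ∫⁻ ζ in Set.Ioo (0 : ℝ) 1,
          ENNReal.ofReal (a * (1 - η * genG a η S ζ) ^ ((a - 1) / η)) := by
  simp only [← h.lintegral_outgrowth S]
  rw [← lintegral_tsum fun o => by
    simp only [prod_treeWeight_mul_pow]
    fun_prop]
  refine setLIntegral_congr_fun measurableSet_Ioo fun ζ hζ => ?_
  rw [ENNReal.tsum_mul_left, tsum_list_prod (fun t => treeWeight a η S t * ENNReal.ofReal ζ ^ size t)
    fun n => ENNReal.ofReal (attachProd a η n), h.tsum_treeWeight S hζ.1.le hζ.2,
    ENNReal.ofReal_mul h.pos.le]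
  congr 1
  have hg := h.genG_nonneg S hζ.1.le
  have hs := h.hasSum_attachProd hg (h.genG_lt S hζ.1.le hζ.2)
  rw [← hs.tsum_eq, ENNReal.ofReal_tsum_of_nonneg _ hs.summable]
  · congr with n
    have hn := h.attachProd_nonneg n
    rw [ENNReal.ofReal_mul (by positivity), ENNReal.ofReal_mul (by positivity),
      ENNReal.ofReal_pow hg, ENNReal.ofReal_add (by positivity) zero_le_one,
      ENNReal.ofReal_natCast, ENNReal.ofReal_one]
  · intro n
    have hn := h.attachProd_nonneg n
    positivity

/-- Without restriction on the trees the integrand is `a (1 - ζ) ^ (a - 1)`, whose integral is one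
since `a > 0`. Thus exactly one subtree becomes infinite in the limit. -/
theorem tsum_outgrowthProb_eq_one : ∑' o, ENNReal.ofReal (outgrowthProb a η o) = 1 := by
  have h1 := h.tsum_outgrowthProb Set.univ
  have h2 : Outgrowth.inSet Set.univ = Set.univ := by simp [Outgrowth.inSet]
  rw [h2, Set.indicator_univ] at h1
  rw [h1]
  have ha := h.pos
  have h3 : ∀ ζ ∈ Set.Ioo (0 : ℝ) 1, (1 - η * genG a η Set.univ ζ) ^ ((a - 1) / η)
      = (1 - ζ) ^ (a - 1) := by
    intro ζ hζ
    rw [h.one_sub_genG_univ hζ.1.le hζ.2, ← Real.rpow_mul (by linarith [hζ.2])]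
    by_cases hη : η = 0
    · obtain ⟨d, hd⟩ : ∃ d : ℕ, D = d := by
        rcases eq_or_ne D ⊤ with hD | hD
        · exact absurd (h.eta_pos hD) (by linarith)
        · exact ⟨D.toNat, (ENat.natCast_toNat hD).symm⟩
      have := h.eta_mul hd
      rw [hη] at this ⊢
      rw [← this]
      simp
    · rw [mul_div_cancel₀ _ hη]
  rw [setLIntegral_congr_fun (g := fun ζ => ENNReal.ofReal (a * (1 - ζ) ^ (a - 1)))
    measurableSet_Ioo fun ζ hζ => by rw [h3 ζ hζ]]
  have hint : IntervalIntegrable (fun ζ : ℝ => (1 - ζ) ^ (a - 1)) volume 0 1 := by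
    have := (intervalIntegral.intervalIntegrable_rpow' (a := 0) (b := 1) (r := a - 1)
      (by linarith)).comp_sub_left 1
    simpa using this.symm
  have hI : ∫ ζ in (0 : ℝ)..1, a * (1 - ζ) ^ (a - 1) = 1 := by
    rw [intervalIntegral.integral_const_mul,
      intervalIntegral.integral_comp_sub_left (fun x => x ^ (a - 1)) 1,
      integral_rpow (Or.inl (by linarith))]
    simp [ha.ne']
  rw [Measure.restrict_congr_set Ioo_ae_eq_Ioc, ← ofReal_integral_eq_lintegral_ofReal,
    ← intervalIntegral.integral_of_le zero_le_one, hI, ENNReal.ofReal_one]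
  · exact ((intervalIntegrable_iff_integrableOn_Ioc_of_le zero_le_one).1 hint).const_mul a
  · filter_upwards [self_mem_ae_restrict measurableSet_Ioc] with ζ hζ
    exact mul_nonneg ha.le (Real.rpow_nonneg (by linarith [hζ.2]) _)

end Admissible

/-! ### Vertices -/

/-- The address `u` is a vertex of the tree with child counts `c`. -/
def IsAddress : (List ℕ → ℕ) → List ℕ → Prop
  | _, [] => True
  | c, j :: u => j < c [] ∧ IsAddress (fun w => c (j :: w)) u

theorem isAddress_append (c : List ℕ → ℕ) (u v : List ℕ) :
    IsAddress c (u ++ v) ↔ IsAddress c u ∧ IsAddress (fun w => c (u ++ w)) v := by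
  induction u generalizing c with
  | nil => simp [IsAddress]
  | cons j u ih => simp [IsAddress, ih, and_assoc]

theorem PlanarTree.isVertex_iff (τ : PlanarTree) (u : List ℕ) :
    PlanarTree.IsVertex τ u ↔ IsAddress τ.1 u := by
  constructor
  · intro hu
    induction hu with
    | root => trivial
    | child _ hj ih => exact (isAddress_append _ _ _).2 ⟨ih, by simpa [IsAddress] using hj⟩
  · induction u using List.reverseRecOn with
    | nil => exact fun _ => PlanarTree.IsVertex.root
    | append_singleton u j ih =>
      intro h
      obtain ⟨h1, h2⟩ := (isAddress_append _ _ _).1 h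
      exact PlanarTree.IsVertex.child (ih h1) (by simpa [IsAddress] using h2)

theorem finite_isAddress (c : List ℕ → ℕ) (n : ℕ) :
    {u : List ℕ | u.length = n ∧ IsAddress c u}.Finite := by
  induction n generalizing c with
  | zero => exact (Set.finite_singleton []).subset fun u hu => List.length_eq_zero_iff.1 hu.1
  | succ n ih =>
    refine ((Set.finite_lt_nat (c [])).biUnion fun j _ =>
      (ih fun w => c (j :: w)).image (List.cons j)).subset ?_
    rintro (_ | ⟨j, u⟩) ⟨h1, h2⟩
    · simp at h1
    · simp only [Set.mem_iUnion]
      exact ⟨j, h2.1, u, ⟨by simpa using h1, h2.2⟩, rfl⟩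

theorem childCount_cons_of_getElem? {T S : FTree} {j : ℕ} (h : T.subtrees[j]? = some S)
    (u : List ℕ) : T.childCount (j :: u) = S.childCount u := by
  simp [childCount, h]

theorem isAddress_childCount_cons (T : FTree) (j : ℕ) (u : List ℕ) :
    IsAddress (fun w => T.childCount w) (j :: u)
      ↔ ∃ S, T.subtrees[j]? = some S ∧ IsAddress (fun w => S.childCount w) u := by
  simp only [IsAddress]
  constructor
  · rintro ⟨h1, h2⟩
    have h3 : T.subtrees[j]? = some (T.subtrees[j]'h1) := List.getElem?_eq_getElem h1
    refine ⟨_, h3, ?_⟩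
    simpa only [childCount_cons_of_getElem? h3] using h2
  · rintro ⟨S, h1, h2⟩
    refine ⟨(List.getElem?_eq_some_iff.1 h1).1, ?_⟩
    simpa only [childCount_cons_of_getElem? h1] using h2

theorem le_heightList_iff {k : ℕ} (hk : 1 ≤ k) (l : List FTree) :
    k ≤ heightList l ↔ ∃ t ∈ l, k ≤ height t := by
  induction l with
  | nil => simp [heightList]; omega
  | cons t l ih => simp [heightList, ih]

/-- Addresses start at the neighbour of the root while `height` is measured from the root, hence the
shift by one. -/
theorem exists_isAddress_iff (T : FTree) (m : ℕ) :
    (∃ u : List ℕ, u.length = m ∧ IsAddress (fun w => T.childCount w) u) ↔ m + 1 ≤ height T := by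
  induction m generalizing T with
  | zero =>
    obtain ⟨l⟩ := T
    simp only [height]
    exact ⟨fun _ => by omega, fun _ => ⟨[], rfl, trivial⟩⟩
  | succ m ih =>
    obtain ⟨l⟩ := T
    rw [height, Nat.add_le_add_iff_right, le_heightList_iff (by omega)]
    constructor
    · rintro ⟨_ | ⟨j, u⟩, h1, h2⟩
      · simp at h1
      · obtain ⟨S, h3, h4⟩ := (isAddress_childCount_cons _ _ _).1 h2
        exact ⟨S, List.mem_of_getElem? h3, (ih S).1 ⟨u, by simpa using h1, h4⟩⟩
    · rintro ⟨S, h1, h2⟩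
      obtain ⟨j, hj⟩ := List.mem_iff_getElem?.1 h1
      obtain ⟨u, h3, h4⟩ := (ih S).2 h2
      exact ⟨j :: u, by simp [h3], (isAddress_childCount_cons _ _ _).2 ⟨S, hj, h4⟩⟩

theorem childCount_injective {T T' : FTree} (h : ∀ u, T.childCount u = T'.childCount u) :
    T = T' := by
  induction T using induction_subtrees generalizing T' with
  | h l ih =>
    obtain ⟨l'⟩ := T'
    have hlen : l.length = l'.length := h []
    congr 1
    refine List.ext_getElem hlen fun j h1 h2 => ih _ (List.getElem_mem h1) fun u => ?_
    have := h (j :: u)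
    rwa [childCount_cons_of_getElem? (List.getElem?_eq_getElem h1),
      childCount_cons_of_getElem? (List.getElem?_eq_getElem h2)] at this

/-! ### The tree with given outgrowths along an infinite spine -/

namespace Outgrowth

/-- The trees of an outgrowth, in planar order, with an edge in the place of the spine. -/
def trees (o : Outgrowth) : List FTree := o.1 ++ edge :: o.2

theorem length_trees (o : Outgrowth) : o.trees.length = o.1.length + 1 + o.2.length := by
  simp [trees]; omega

theorem getElem?_graft (o : Outgrowth) (T : FTree) (j : ℕ) :
    (graft o T).subtrees[j]? = if j = o.1.length then some T else o.trees[j]? := by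
  simp only [graft, subtrees, trees]
  split_ifs with h
  · simp [h]
  · rcases lt_or_gt_of_ne h with h | h
    · rw [List.getElem?_append_left h, List.getElem?_append_left h]
    · rw [List.getElem?_append_right h.le, List.getElem?_append_right h.le]
      obtain ⟨k, hk⟩ : ∃ k, j - o.1.length = k + 1 := ⟨j - o.1.length - 1, by omega⟩
      simp [hk]

theorem exists_getElem?_trees (o : Outgrowth) (S : FTree) :
    (∃ j, j ≠ o.1.length ∧ o.trees[j]? = some S) ↔ S ∈ o.1 ∨ S ∈ o.2 := by
  simp only [trees]
  constructor
  · rintro ⟨j, h, hj⟩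
    rcases lt_or_gt_of_ne h with h | h
    · rw [List.getElem?_append_left h] at hj
      exact Or.inl (List.mem_of_getElem? hj)
    · rw [List.getElem?_append_right h.le] at hj
      obtain ⟨k, hk⟩ : ∃ k, j - o.1.length = k + 1 := ⟨j - o.1.length - 1, by omega⟩
      rw [hk, List.getElem?_cons_succ] at hj
      exact Or.inr (List.mem_of_getElem? hj)
  · rintro (h | h)
    · obtain ⟨j, hj⟩ := List.mem_iff_getElem?.1 h
      have hlt := (List.getElem?_eq_some_iff.1 hj).1
      exact ⟨j, hlt.ne, by rw [List.getElem?_append_left hlt, hj]⟩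
    · obtain ⟨k, hk⟩ := List.mem_iff_getElem?.1 h
      refine ⟨o.1.length + (k + 1), by omega, ?_⟩
      rw [List.getElem?_append_right (by omega)]
      simpa using hk

end Outgrowth

/-- The child counts of the tree with outgrowths `ω 0, ω 1, …` along its spine, with addresses
relative to the neighbour of the root. -/
def spineCount : List ℕ → (ℕ → Outgrowth) → ℕ
  | [], ω => (ω 0).trees.length
  | j :: u, ω =>
      if j = (ω 0).1.length then spineCount u fun n => ω (n + 1)
      else
        match (ω 0).trees[j]? with
        | some S => S.childCount u
        | none => 0

theorem spineCount_append (u : List ℕ) (j : ℕ) (ω : ℕ → Outgrowth)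
    (h : spineCount u ω ≤ j) : spineCount (u ++ [j]) ω = 0 := by
  induction u generalizing ω with
  | nil =>
    simp only [spineCount] at h
    have hl := (ω 0).length_trees
    rw [List.nil_append, spineCount, if_neg (by omega), List.getElem?_eq_none h]
  | cons i u ih =>
    simp only [spineCount, List.cons_append] at h ⊢
    split_ifs at h ⊢ with hi
    · exact ih _ h
    · cases hS : (ω 0).trees[i]? with
      | none => rfl
      | some S =>
        rw [hS] at h
        exact childCount_append u j S h

/-- The tree with outgrowths `ω 0, ω 1, …` along its spine. -/
def spineTree (ω : ℕ → Outgrowth) : PlanarTree :=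
  ⟨fun
    | [] => 1
    | 0 :: u => spineCount u ω
    | (_ + 1) :: _ => 0, rfl, by
    intro u j h
    match u, j, h with
    | [], 0, h => simp at h
    | [], j + 1, _ => rfl
    | 0 :: u, j, h => exact spineCount_append u j ω h
    | (_ + 1) :: _, _, _ => rfl⟩

/-- The address, relative to the neighbour of the root, of a vertex of the spine. -/
def spinePath (ω : ℕ → Outgrowth) (n : ℕ) : List ℕ := (List.range n).map fun k => (ω k).1.length

theorem spinePath_succ (ω : ℕ → Outgrowth) (n : ℕ) :
    spinePath ω (n + 1) = spinePath ω n ++ [(ω n).1.length] := by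
  simp [spinePath, List.range_succ]

theorem spineCount_spinePath_append (ω : ℕ → Outgrowth) (n : ℕ) (v : List ℕ) :
    spineCount (spinePath ω n ++ v) ω = spineCount v fun k => ω (n + k) := by
  induction n generalizing v with
  | zero => simp [spinePath]
  | succ n ih =>
    rw [spinePath_succ, List.append_assoc, ih, List.singleton_append, spineCount]
    simp only [add_zero, if_true]
    congr 1
    funext k
    rw [show n + (k + 1) = n + 1 + k by ring]

/-- The addresses of the vertices of the spine of `spineTree ω`. -/
def spine (ω : ℕ → Outgrowth) : ℕ → List ℕ
  | 0 => []
  | n + 1 => 0 :: spinePath ω n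

theorem spine_add_two (ω : ℕ → Outgrowth) (n : ℕ) :
    spine ω (n + 2) = spine ω (n + 1) ++ [(ω n).1.length] := by
  simp [spine, spinePath_succ]

theorem spineTree_spine_append (ω : ℕ → Outgrowth) (n : ℕ) (v : List ℕ) :
    (spineTree ω).1 (spine ω (n + 1) ++ v) = spineCount v fun k => ω (n + k) :=
  spineCount_spinePath_append ω n v

theorem isSpine_spine (ω : ℕ → Outgrowth) : (spineTree ω).IsSpine (spine ω) := by
  refine ⟨rfl, fun n => ?_⟩
  rcases n with _ | n
  · exact ⟨0, Nat.one_pos, rfl⟩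
  · refine ⟨(ω n).1.length, ?_, spine_add_two ω n⟩
    have := spineTree_spine_append ω n []
    rw [List.append_nil] at this
    rw [this, spineCount, Outgrowth.length_trees]
    simp only [add_zero]
    omega

theorem isAddress_spineCount_cons (ω : ℕ → Outgrowth) {j : ℕ} (hj : j ≠ (ω 0).1.length)
    (u : List ℕ) : IsAddress (fun w => spineCount w ω) (j :: u)
      ↔ ∃ S, (ω 0).trees[j]? = some S ∧ IsAddress (fun w => S.childCount w) u := by
  simp only [IsAddress, spineCount, hj, if_false]
  constructor
  · rintro ⟨h1, h2⟩
    have h3 : (ω 0).trees[j]? = some ((ω 0).trees[j]'h1) := List.getElem?_eq_getElem h1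
    refine ⟨_, h3, ?_⟩
    simpa only [h3] using h2
  · rintro ⟨S, h1, h2⟩
    refine ⟨(List.getElem?_eq_some_iff.1 h1).1, ?_⟩
    simpa only [h1] using h2

theorem PlanarTree.IsSpine.exists_append {τ : PlanarTree} {s : ℕ → List ℕ} (hs : τ.IsSpine s)
    (n m : ℕ) : ∃ v : List ℕ, v.length = m ∧ s (n + m) = s n ++ v
      ∧ IsAddress (fun w => τ.1 (s n ++ w)) v := by
  induction m with
  | zero => exact ⟨[], rfl, by simp, trivial⟩
  | succ m ih =>
    obtain ⟨v, h1, h2, h3⟩ := ih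
    obtain ⟨j, h4, h5⟩ := hs.2 (n + m)
    refine ⟨v ++ [j], by simp [h1], ?_, ?_⟩
    · rw [← add_assoc, h5, h2, List.append_assoc]
    · refine (isAddress_append _ _ _).2 ⟨h3, ?_⟩
      rw [h2] at h4
      simpa [IsAddress] using h4

/-- At its first departure from `spine ω` a path would enter a finite tree `S` of the outgrowth and
have to continue there beyond its height. -/
theorem eq_spine {ω : ℕ → Outgrowth} {s : ℕ → List ℕ} (hs : (spineTree ω).IsSpine s) :
    s = spine ω := by
  have key : ∀ n, s (n + 1) = spine ω (n + 1) := by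
    intro n
    induction n with
    | zero =>
      obtain ⟨j, h1, h2⟩ := hs.2 0
      rw [hs.1] at h1 h2
      have : j = 0 := Nat.lt_one_iff.1 h1
      rw [h2, this]
      rfl
    | succ n ih =>
      obtain ⟨j, -, h2⟩ := hs.2 (n + 1)
      rw [h2, ih, spine_add_two]
      by_contra hne
      have hj : j ≠ (ω n).1.length := fun h => hne (by rw [h])
      have hex : ∀ m, ∃ v : List ℕ, v.length = m + 1 ∧ s (n + 1 + (m + 1)) = s (n + 1) ++ v
          ∧ IsAddress (fun w => spineCount w fun k => ω (n + k)) v := by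
        intro m
        obtain ⟨v, h3, h4, h5⟩ := hs.exists_append (n + 1) (m + 1)
        simp only [ih, spineTree_spine_append] at h5
        exact ⟨v, h3, h4, h5⟩
      have hv : ∀ m, ∃ u : List ℕ, u.length = m ∧
          IsAddress (fun w => spineCount w fun k => ω (n + k)) (j :: u) := by
        intro m
        obtain ⟨v, h3, h4, h5⟩ := hex m
        obtain ⟨u, -, h7, -⟩ := hs.exists_append (n + 1 + 1) m
        rw [show n + 1 + 1 + m = n + 1 + (m + 1) by ring, h4, h2, List.append_assoc] at h7
        obtain rfl := List.append_cancel_left h7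
        exact ⟨u, by simpa using h3, h5⟩
      obtain ⟨u, -, hu⟩ := hv 0
      obtain ⟨S, hS, -⟩ := (isAddress_spineCount_cons (fun k => ω (n + k)) hj u).1 hu
      obtain ⟨u', hu1, hu2⟩ := hv (height S)
      obtain ⟨S', hS', h6⟩ := (isAddress_spineCount_cons (fun k => ω (n + k)) hj u').1 hu2
      obtain rfl : S = S' := by rw [hS] at hS'; simpa using hS'
      have := (exists_isAddress_iff S (height S)).1 ⟨u', hu1, h6⟩
      omega
  funext n
  rcases n with _ | n
  · exact hs.1
  · exact key n

theorem existsUnique_isSpine (ω : ℕ → Outgrowth) : ∃! s, (spineTree ω).IsSpine s :=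
  ⟨spine ω, isSpine_spine ω, fun _ hs => eq_spine hs⟩

/-- Uniqueness of the spine recovers its position among the children of each spine vertex; the child
counts off the spine then recover the planted trees. -/
theorem spineTree_injective : Function.Injective spineTree := by
  intro ω ω' h
  have hsp : spine ω' = spine ω := eq_spine (h ▸ isSpine_spine ω')
  have hL : ∀ n, (ω' n).1.length = (ω n).1.length := by
    intro n
    have := congrFun hsp (n + 2)
    rw [spine_add_two, spine_add_two, congrFun hsp (n + 1)] at this
    simpa using this
  have hc : ∀ n v, spineCount v (fun k => ω (n + k)) = spineCount v fun k => ω' (n + k) := by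
    intro n v
    rw [← spineTree_spine_append, ← spineTree_spine_append, hsp, h]
  funext n
  have hlen : (ω n).trees.length = (ω' n).trees.length := hc n []
  have htr : (ω n).trees = (ω' n).trees := by
    refine List.ext_getElem hlen fun j h1 h2 => ?_
    by_cases hj : j = (ω n).1.length
    · subst hj
      simp only [Outgrowth.trees]
      rw [List.getElem_append_right le_rfl, List.getElem_append_right (hL n).le]
      simp [hL n]
    · refine childCount_injective fun u => ?_
      have := hc n (j :: u)
      simp only [spineCount, add_zero] at this
      rw [if_neg hj, if_neg (by rw [hL n]; exact hj), List.getElem?_eq_getElem h1,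
        List.getElem?_eq_getElem h2] at this
      exact this
  obtain ⟨h1, h2⟩ := List.append_inj htr (hL n).symm
  exact Prod.ext h1 (List.cons.inj h2).2

theorem outgrowthSize_spineTree (ω : ℕ → Outgrowth) (n R : ℕ) :
    (spineTree ω).outgrowthSize (spine ω) (n + 1) (R + 1) = 0
      ↔ ω n ∈ Outgrowth.inSet {T | height T ≤ R} := by
  -- Finiteness is needed because `ncard` is also zero on infinite sets.
  have hfin : ((spineTree ω).outgrowthLevel (spine ω) (n + 1) (R + 1)).Finite :=
    (finite_isAddress (spineTree ω).1 ((spine ω (n + 1)).length + (R + 1))).subset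
      fun u hu => ⟨hu.2.2.2, ((spineTree ω).isVertex_iff u).1 hu.1⟩
  rw [PlanarTree.outgrowthSize, Set.ncard_eq_zero hfin]
  have hsp : IsAddress (spineTree ω).1 (spine ω (n + 1)) := by
    obtain ⟨v, -, h2, h3⟩ := (isSpine_spine ω).exists_append 0 (n + 1)
    rw [zero_add] at h2
    rw [h2]
    simpa [spine] using h3
  have hiff : ∀ v : List ℕ, IsAddress (spineTree ω).1 (spine ω (n + 1) ++ v)
      ↔ IsAddress (fun w => spineCount w fun k => ω (n + k)) v := by
    intro v
    rw [isAddress_append]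
    simp only [spineTree_spine_append, hsp, true_and]
  have hex : ((spineTree ω).outgrowthLevel (spine ω) (n + 1) (R + 1)).Nonempty
      ↔ ∃ S, (S ∈ (ω n).1 ∨ S ∈ (ω n).2) ∧ R + 1 ≤ height S := by
    constructor
    · rintro ⟨u, h1, ⟨v, rfl⟩, h3, h4⟩
      rw [PlanarTree.isVertex_iff, hiff] at h1
      rcases v with _ | ⟨j, v⟩
      · simp at h4
      have hj : j ≠ (ω n).1.length := by
        rintro rfl
        exact h3 ⟨v, by rw [spine_add_two]; simp⟩
      obtain ⟨S, hS, h5⟩ := (isAddress_spineCount_cons (fun k => ω (n + k)) hj v).1 h1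
      refine ⟨S, ((ω n).exists_getElem?_trees S).1 ⟨j, hj, hS⟩,
        (exists_isAddress_iff S R).1 ⟨v, ?_, h5⟩⟩
      simpa using h4
    · rintro ⟨S, hS, hR⟩
      obtain ⟨j, hj, hjS⟩ := ((ω n).exists_getElem?_trees S).2 hS
      obtain ⟨v, hv, hvS⟩ := (exists_isAddress_iff S R).2 hR
      refine ⟨spine ω (n + 1) ++ j :: v, ?_, List.prefix_append _ _, ?_, by simp [hv]⟩
      · rw [PlanarTree.isVertex_iff, hiff]
        exact (isAddress_spineCount_cons (fun k => ω (n + k)) hj v).2 ⟨S, hjS, hvS⟩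
      · rw [spine_add_two, List.prefix_append_right_inj]
        rintro ⟨w, hw⟩
        simp only [List.singleton_append, List.cons.injEq] at hw
        exact hj hw.1.symm
  rw [← Set.not_nonempty_iff_eq_empty, hex]
  simp only [Outgrowth.inSet, Set.mem_ofPred_eq, not_exists, not_and, not_le, Nat.lt_succ_iff]
  constructor
  · exact fun hS => ⟨fun t ht => hS t (Or.inl ht), fun t ht => hS t (Or.inr ht)⟩
  · rintro ⟨h1, h2⟩ S (hS | hS)
    · exact h1 S hS
    · exact h2 S hS

/-! ### Approximation by finite trees -/

theorem childCount_graftList (ω : ℕ → Outgrowth) (k : ℕ) (T : FTree) (u : List ℕ)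
    (hu : u.length < k) :
    (Outgrowth.graftList ((List.range k).map ω) T).childCount u = spineCount u ω := by
  induction k generalizing ω u with
  | zero => omega
  | succ k ih =>
    rw [List.range_succ_eq_map, List.map_cons, List.map_map, Outgrowth.graftList]
    rcases u with _ | ⟨j, u⟩
    · simp [childCount, spineCount, Outgrowth.graft, Outgrowth.trees, subtrees]
    · rw [childCount, Outgrowth.getElem?_graft, spineCount]
      split_ifs with hj
      · exact ih (fun n => ω (n + 1)) u (by simpa using hu)
      · rfl

theorem rootedCount_graftList (ω : ℕ → Outgrowth) (k : ℕ) (T : FTree) (u : List ℕ)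
    (hu : u.length ≤ k) :
    (Outgrowth.graftList ((List.range k).map ω) T).toPlanarTree.1 u = (spineTree ω).1 u := by
  rcases u with _ | ⟨_ | j, u⟩
  · rfl
  · exact childCount_graftList ω k T u (by simpa using hu)
  · rfl

/-- A basic neighbourhood inspects finitely many addresses. Up to their maximal length `k`, the tree
is determined by the first `k` outgrowths, whatever is grafted at the end. -/
theorem exists_graftList_mem {G : Set PlanarTree} (hG : IsOpen G) {ω : ℕ → Outgrowth}
    (hω : spineTree ω ∈ G) :
    ∃ k, ∀ T, (Outgrowth.graftList ((List.range k).map ω) T).toPlanarTree ∈ G := by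
  obtain ⟨s, hs, rfl⟩ := isOpen_induced_iff.1 hG
  obtain ⟨I, V, h1, h2⟩ := isOpen_pi_iff.1 hs _ hω
  refine ⟨I.sup List.length, fun T => h2 fun u hu => ?_⟩
  rw [rootedCount_graftList ω _ T u (Finset.le_sup (f := List.length) hu)]
  exact (h1 u hu).2

theorem Outgrowth.graftList_append (p : List Outgrowth) (o : Outgrowth) (T : FTree) :
    Outgrowth.graftList (p ++ [o]) T = Outgrowth.graftList p (Outgrowth.graft o T) := by
  induction p with
  | nil => rfl
  | cons q p ih => rw [List.cons_append, Outgrowth.graftList, ih, Outgrowth.graftList]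

/-! ### The law of the infinite tree -/

instance : MeasurableSpace Outgrowth := ⊤

instance : DiscreteMeasurableSpace Outgrowth := ⟨fun _ => trivial⟩

theorem measurable_spineCount (u : List ℕ) : Measurable (spineCount u) := by
  have h0 : Measurable fun ω : ℕ → Outgrowth => ω 0 := measurable_pi_apply 0
  induction u with
  | nil => exact (Measurable.of_discrete (f := fun o : Outgrowth => o.trees.length)).comp h0
  | cons j u ih =>
    refine Measurable.ite ?_ (ih.comp (measurable_pi_lambda _ fun n => measurable_pi_apply (n + 1)))
      ?_
    · exact h0 (MeasurableSet.of_discrete (s := {o : Outgrowth | j = o.1.length}))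
    · exact (Measurable.of_discrete (f := fun o : Outgrowth =>
        match o.trees[j]? with
        | some S => S.childCount u
        | none => 0)).comp h0

theorem measurable_spineTree : Measurable spineTree := by
  refine Measurable.subtype_mk (measurable_pi_lambda _ fun u => ?_)
  rcases u with _ | ⟨_ | j, u⟩
  · exact measurable_const
  · exact measurable_spineCount u
  · exact measurable_const

/-- By Lusin–Souslin, injectivity suffices on the standard Borel space of outgrowth sequences. This
lets `limitLaw_apply` hold for arbitrary sets, so events quantifying over spines need no
measurability proof. -/
theorem measurableEmbedding_spineTree : MeasurableEmbedding spineTree :=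
  measurable_spineTree.measurableEmbedding spineTree_injective

theorem prod_map_eq_prod_range {M : Type*} [CommMonoid M] (f : Outgrowth → M)
    (p : List Outgrowth) :
    (p.map f).prod = ∏ i ∈ Finset.range p.length, f (p.getD i ([], [])) := by
  induction p with
  | nil => simp
  | cons o p ih => simp [Finset.prod_range_succ', ih, mul_comm]

theorem map_range_eq_iff (ω : ℕ → Outgrowth) (p : List Outgrowth) :
    (List.range p.length).map ω = p ↔ ∀ i ∈ Finset.range p.length, ω i = p.getD i ([], []) := by
  constructor
  · intro h i hi
    have hi := Finset.mem_range.1 hi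
    rw [List.getD_eq_getElem _ _ hi]
    have := List.getElem_of_eq h (i := i) (by simpa using hi)
    simpa using this
  · intro h
    refine List.ext_getElem (by simp) fun i h1 h2 => ?_
    rw [List.getElem_map, List.getElem_range, h i (Finset.mem_range.2 h2),
      List.getD_eq_getElem _ _ h2]

namespace Admissible
variable {a η : ℝ} {D : ℕ∞} (h : Admissible a η D)

/-- The law of the outgrowth at a vertex of the spine. -/
def outgrowthPMF : PMF Outgrowth :=
  ⟨fun o => ENNReal.ofReal (outgrowthProb a η o),
    h.tsum_outgrowthProb_eq_one ▸ ENNReal.summable.hasSum⟩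

/-- The law of the sequence of outgrowths along the spine. -/
def spineLaw : Measure (ℕ → Outgrowth) := Measure.infinitePi fun _ => h.outgrowthPMF.toMeasure

instance : IsProbabilityMeasure h.spineLaw := by unfold spineLaw; infer_instance

/-- The law of the infinite tree. -/
def limitLaw : Measure PlanarTree := h.spineLaw.map spineTree

instance : IsProbabilityMeasure h.limitLaw :=
  Measure.isProbabilityMeasure_map measurable_spineTree.aemeasurable

theorem limitLaw_apply (S : Set PlanarTree) : h.limitLaw S = h.spineLaw (spineTree ⁻¹' S) :=
  measurableEmbedding_spineTree.map_apply _ _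

theorem spineLaw_cylinder (p : List Outgrowth) :
    h.spineLaw {ω | (List.range p.length).map ω = p}
      = ENNReal.ofReal (p.map (outgrowthProb a η)).prod := by
  have h1 : {ω : ℕ → Outgrowth | (List.range p.length).map ω = p}
      = Set.pi (Finset.range p.length) fun i => {p.getD i ([], [])} := by
    ext ω
    simp only [Set.mem_ofPred_eq, map_range_eq_iff, Set.mem_pi, Set.mem_singleton_iff,
      Finset.mem_coe]
  rw [h1, spineLaw, Measure.infinitePi_pi _ fun _ _ => MeasurableSet.of_discrete,
    prod_map_eq_prod_range, ENNReal.ofReal_prod_of_nonneg fun _ _ => h.outgrowthProb_nonneg _]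
  refine Finset.prod_congr rfl fun i _ => ?_
  rw [PMF.toMeasure_apply_singleton _ _ MeasurableSet.of_discrete]
  rfl

theorem spineLaw_eval (n : ℕ) (S : Set FTree) :
    h.spineLaw {ω | ω n ∈ Outgrowth.inSet S} = ∫⁻ ζ in Set.Ioo (0 : ℝ) 1,
      ENNReal.ofReal (a * (1 - η * genG a η S ζ) ^ ((a - 1) / η)) := by
  have h1 := (measurePreserving_eval_infinitePi (fun _ : ℕ => h.outgrowthPMF.toMeasure) n
    ).measure_preimage (s := Outgrowth.inSet S) MeasurableSet.of_discrete.nullMeasurableSet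
  rw [← h.tsum_outgrowthProb S]
  refine h1.trans ?_
  rw [PMF.toMeasure_apply _ (hs := MeasurableSet.of_discrete)]
  rfl

theorem limitLaw_ae_existsUnique : ∀ᵐ τ ∂h.limitLaw, ∃! s, PlanarTree.IsSpine τ s := by
  rw [ae_iff, limitLaw_apply]
  convert measure_empty (μ := h.spineLaw)
  ext ω
  simpa using existsUnique_isSpine ω

theorem limitLaw_extinct (n R : ℕ) :
    h.limitLaw {τ | ∃ s, PlanarTree.IsSpine τ s ∧ τ.outgrowthSize s (n + 1) (R + 1) = 0}
      = ∫⁻ ζ in Set.Ioo (0 : ℝ) 1,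
        ENNReal.ofReal (a * (1 - η * genG a η {T | height T ≤ R} ζ) ^ ((a - 1) / η)) := by
  rw [limitLaw_apply, ← h.spineLaw_eval n]
  congr 1
  ext ω
  rw [Set.mem_preimage, Set.mem_ofPred_eq, Set.mem_ofPred_eq, ← outgrowthSize_spineTree]
  constructor
  · rintro ⟨s, hs, h1⟩
    rwa [eq_spine hs] at h1
  · exact fun h1 => ⟨spine ω, isSpine_spine ω, h1⟩

/-- Approximate the mass of `G` from below by finitely many cylinders: continuity from below selects
a depth `k`, and truncating a countable sum selects finitely many outgrowth lists. On these
`exists_tendsto_le_expect` applies. -/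
theorem limitLaw_le_of_isOpen {G : Set PlanarTree} (hG : IsOpen G) {c : ℝ≥0∞}
    (hc : c < h.limitLaw G) :
    ∀ᶠ n in atTop, c < ENNReal.ofReal (setProb a η (toPlanarTree ⁻¹' G) n) := by
  set good : ℕ → Set (List Outgrowth) := fun k =>
    {p | p.length = k ∧ ∀ T, (Outgrowth.graftList p T).toPlanarTree ∈ G} with hgood
  set U : ℕ → Set (ℕ → Outgrowth) := fun k => {ω | (List.range k).map ω ∈ good k} with hU
  have hmono : Monotone U := by
    refine monotone_nat_of_le_succ fun k ω hω => ⟨by simp, fun T => ?_⟩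
    rw [List.range_succ, List.map_append, List.map_singleton, Outgrowth.graftList_append]
    exact hω.2 _
  have hsub : spineTree ⁻¹' G ⊆ ⋃ k, U k := by
    intro ω hω
    obtain ⟨k, hk⟩ := exists_graftList_mem hG hω
    exact Set.mem_iUnion.2 ⟨k, by simp, hk⟩
  rw [limitLaw_apply] at hc
  have hc1 := hc.trans_le (measure_mono hsub)
  rw [hmono.measure_iUnion, lt_iSup_iff] at hc1
  obtain ⟨k, hk⟩ := hc1
  have hUk : U k ⊆ ⋃ p : good k, {ω | (List.range p.1.length).map ω = p.1} := by
    intro ω hω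
    refine Set.mem_iUnion.2 ⟨⟨_, hω⟩, ?_⟩
    simp
  have hk2 := hk.trans_le ((measure_mono hUk).trans (measure_iUnion_le _))
  simp only [spineLaw_cylinder] at hk2
  rw [ENNReal.tsum_eq_iSup_sum, lt_iSup_iff] at hk2
  obtain ⟨F, hF⟩ := hk2
  obtain ⟨f, hf1, hf2⟩ := h.exists_tendsto_le_expect (F := F.map (Function.Embedding.subtype _))
    (k := k) (S := toPlanarTree ⁻¹' G) (by
      intro p hp
      obtain ⟨q, -, rfl⟩ := Finset.mem_map.1 hp
      exact q.2.1) (by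
      intro p hp T
      obtain ⟨q, -, rfl⟩ := Finset.mem_map.1 hp
      exact q.2.2 T)
  rw [Finset.sum_map] at hf1
  rw [← ENNReal.ofReal_sum_of_nonneg fun p _ => list_prod_nonneg h.outgrowthProb_nonneg _] at hF
  filter_upwards [(ENNReal.tendsto_ofReal hf1).eventually_const_lt hF] with n hn
  exact hn.trans_le (ENNReal.ofReal_le_ofReal (hf2 n))

end Admissible

-- Finite volume measures, the model parameters and the function `H_R`

theorem Admissible.nuMeasure_apply {a g : ℝ} {D : ℕ∞} (h : Admissible a (eta a g D) D) (n : ℕ)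
    {S : Set PlanarTree} (hS : MeasurableSet S) :
    nuMeasure a g D n S = ENNReal.ofReal (setProb a (eta a g D) (toPlanarTree ⁻¹' S) n) := by
  classical
  have hs := hasSum_nu_mul a g D n ((toPlanarTree ⁻¹' S).indicator 1)
  have hnn : ∀ T, 0 ≤ nu a g D n T := fun T => by
    rw [nu_eq]
    exact h.expect_nonneg fun S => by split_ifs <;> simp
  rw [setProb, ← hs.tsum_eq, ENNReal.ofReal_tsum_of_nonneg (fun T => mul_nonneg (hnn T)
    (Set.indicator_nonneg (f := (1 : FTree → ℝ)) (fun _ _ => zero_le_one) _)) hs.summable, nuMeasure,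
    Measure.sum_apply _ hS]
  congr with T
  rw [Measure.smul_apply, Measure.dirac_apply' _ hS, ENNReal.ofReal_mul (hnn T), smul_eq_mul]
  by_cases hT : T.toPlanarTree ∈ S
  · simp [hT]
  · simp [hT]

theorem Admissible.isProbabilityMeasure_nuMeasure {a g : ℝ} {D : ℕ∞}
    (h : Admissible a (eta a g D) D) (n : ℕ) : IsProbabilityMeasure (nuMeasure a g D (n + 1)) :=
  ⟨by rw [h.nuMeasure_apply _ MeasurableSet.univ, Set.preimage_univ, h.setProb_univ (by omega),
    ENNReal.ofReal_one]⟩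

theorem admissible_eta {α γ : ℝ} {D : ℕ∞} (hα₀ : 0 < α) (hα₁ : α ≤ 1) (hγ₀ : 0 ≤ γ)
    (hD : 3 ≤ D) (hη : D = ⊤ → γ < 1) : Admissible α (eta α γ D) D := by
  rcases eq_or_ne D ⊤ with rfl | hD'
  · have := hη rfl
    have he : eta α γ ⊤ = 1 - γ := by simp [eta]
    rw [he]
    refine ⟨hα₀, hα₁, by linarith, hD, fun k hk _ => ?_, fun k hk => absurd hk (by simp),
      fun _ => by linarith⟩
    have hk' : (2 : ℝ) ≤ k := by exact_mod_cast hk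
    nlinarith
  · lift D to ℕ using hD'
    have hD3 : 3 ≤ D := by exact_mod_cast hD
    have hD3' : (3 : ℝ) ≤ D := by exact_mod_cast hD3
    have hd : (0 : ℝ) < (D : ℝ) - 2 := by linarith
    have he : eta α γ D = -((1 - α) / ((D : ℝ) - 2)) := by simp [eta]
    have hq : 0 ≤ (1 - α) / ((D : ℝ) - 2) := div_nonneg (by linarith) hd.le
    -- For finite `D` the attachment weight at degree `k` is `-η (D - k)`: nonnegative up to `D` and
    -- zero at `D`.
    have hw : ∀ k : ℕ, -((1 - α) / ((D : ℝ) - 2)) * k + 1 - 2 * -((1 - α) / ((D : ℝ) - 2)) - α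
        = (1 - α) / ((D : ℝ) - 2) * ((D : ℝ) - k) := by
      intro k
      field_simp
      ring
    rw [he]
    refine ⟨hα₀, hα₁, by linarith, hD, fun k _ hkD => ?_, fun k hkD => ?_,
      fun h => absurd h (by simp)⟩
    · rw [hw]
      have : (k : ℝ) ≤ D := by exact_mod_cast hkD
      exact mul_nonneg hq (by linarith)
    · rw [hw]
      have : k = D := by exact_mod_cast hkD
      rw [this, sub_self, mul_zero]

section genH
variable {a g : ℝ} {D : ℕ∞} (h : Admissible a (eta a g D) D)
include h

theorem Admissible.hasSum_coeffC (R : ℕ) {ζ : ℝ} (h0 : 0 ≤ ζ) (h1 : ζ < 1) :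
    HasSum (fun n => coeffC a g D n R * ζ ^ n)
      (1 - eta a g D * genG a (eta a g D) {T | height T ≤ R} ζ) := by
  refine h.hasSum_gammaFactor_mul _ (Q := fun n => nuHeight a g D n R) rfl (fun n hn => ?_) h0 h1
  rw [nuHeight, if_neg (by omega), setProb, ← (hasSum_nu_mul a g D n _).tsum_eq]
  congr with T
  by_cases hT : height T ≤ R <;> simp [hT]

theorem Admissible.genH_eq (R : ℕ) {ζ : ℝ} (h0 : 0 ≤ ζ) (h1 : ζ < 1) :
    genH a g D R ζ = 1 - eta a g D * genG a (eta a g D) {T | height T ≤ R} ζ :=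
  (h.hasSum_coeffC R h0 h1).tsum_eq

theorem Admissible.limitLaw_extinct_genH (n R : ℕ) :
    h.limitLaw {τ | ∃ s, PlanarTree.IsSpine τ s ∧ τ.outgrowthSize s (n + 1) (R + 1) = 0}
      = ∫⁻ ζ in Set.Ioc (0 : ℝ) 1,
        ENNReal.ofReal (a * genH a g D R ζ ^ ((a - 1) / eta a g D)) := by
  rw [h.limitLaw_extinct, ← Measure.restrict_congr_set Ioo_ae_eq_Ioc]
  exact setLIntegral_congr_fun measurableSet_Ioo fun ζ hζ => by rw [h.genH_eq R hζ.1.le hζ.2]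

theorem Admissible.genH_rpow_nonneg (R : ℕ) :
    0 ≤ᵐ[volume.restrict (Set.Ioc (0 : ℝ) 1)]
      fun ζ => a * genH a g D R ζ ^ ((a - 1) / eta a g D) := by
  rw [← Measure.restrict_congr_set Ioo_ae_eq_Ioc]
  filter_upwards [self_mem_ae_restrict measurableSet_Ioo] with ζ hζ
  refine mul_nonneg h.pos.le (Real.rpow_nonneg ?_ _)
  rw [h.genH_eq R hζ.1.le hζ.2]
  linarith [h.genG_lt {T | height T ≤ R} hζ.1.le hζ.2]

/-- No estimate of the integrand is needed: its integral is an extinction probability, hence finite.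
-/
theorem Admissible.integrable_genH (R : ℕ) :
    IntegrableOn (fun ζ => a * genH a g D R ζ ^ ((a - 1) / eta a g D)) (Set.Ioc (0 : ℝ) 1) := by
  have hm : Measurable (genH a g D R) := Measurable.tsum fun n => by fun_prop
  refine ⟨((hm.pow_const _).const_mul a).aestronglyMeasurable, ?_⟩
  rw [hasFiniteIntegral_iff_ofReal (h.genH_rpow_nonneg R), ← h.limitLaw_extinct_genH 0]
  exact measure_lt_top _ _

end genH

end AG

end

theorem proposition1 (α γ : ℝ) (D : ℕ∞) (hα₀ : 0 < α) (hα₁ : α ≤ 1) (hγ₀ : 0 ≤ γ) (hγ₁ : γ ≤ 1)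
    (hD : 3 ≤ D) (hη : D = ⊤ → γ < 1) :
    ∃ (P : ℕ → ProbabilityMeasure AG.PlanarTree) (ν : ProbabilityMeasure AG.PlanarTree),
      (∀ n, (P n : Measure AG.PlanarTree) = AG.nuMeasure α γ D (n + 1)) ∧
      Tendsto P atTop (𝓝 ν) ∧
      (∀ᵐ τ ∂(ν : Measure AG.PlanarTree), ∃! s, AG.PlanarTree.IsSpine τ s) ∧
      ∀ R : ℕ,
        (∀ ζ ∈ Set.Ico (0 : ℝ) 1, Summable fun n : ℕ => AG.coeffC α γ D n R * ζ ^ n) ∧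
        IntervalIntegrable (fun ζ => AG.genH α γ D R ζ ^ ((α - 1) / AG.eta α γ D)) volume 0 1 ∧
        ∀ i : ℕ, 1 ≤ i →
          (ν : Measure AG.PlanarTree).real
              {τ | ∃ s, AG.PlanarTree.IsSpine τ s ∧
                AG.PlanarTree.outgrowthSize τ s i (R + 1) = 0}
            = α * ∫ ζ in (0 : ℝ)..1, AG.genH α γ D R ζ ^ ((α - 1) / AG.eta α γ D) := by
  have h := AG.admissible_eta hα₀ hα₁ hγ₀ hD hη
  refine ⟨fun n => ⟨AG.nuMeasure α γ D (n + 1), h.isProbabilityMeasure_nuMeasure n⟩,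
    ⟨h.limitLaw, inferInstance⟩, fun n => rfl, ?_, h.limitLaw_ae_existsUnique, fun R => ⟨?_, ?_, ?_⟩⟩
  -- Portmanteau: lower bounds on open sets suffice because the limit has total mass one.
  · refine tendsto_of_forall_isOpen_le_liminf_nat' fun G hG => ?_
    refine le_of_forall_lt fun c hc => ?_
    obtain ⟨c', hc', hc''⟩ := exists_between hc
    refine hc'.trans_le (le_liminf_of_le (by isBoundedDefault) ?_)
    filter_upwards [(tendsto_add_atTop_nat 1).eventually (h.limitLaw_le_of_isOpen hG hc'')] with n hn
    exact hn.le.trans_eq (h.nuMeasure_apply (n + 1) hG.measurableSet).symm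
  · exact fun ζ hζ => (h.hasSum_coeffC R hζ.1 hζ.2).summable
  · rw [intervalIntegrable_iff_integrableOn_Ioc_of_le zero_le_one]
    have := (h.integrable_genH R).const_mul α⁻¹
    simp only [inv_mul_cancel_left₀ hα₀.ne'] at this
    exact this
  · intro i hi
    obtain ⟨n, rfl⟩ : ∃ n, i = n + 1 := ⟨i - 1, by omega⟩
    rw [measureReal_def, ← intervalIntegral.integral_const_mul,
      intervalIntegral.integral_of_le zero_le_one,
      integral_eq_lintegral_of_nonneg_ae (h.genH_rpow_nonneg R)
        (h.integrable_genH R).aestronglyMeasurable, ← h.limitLaw_extinct_genH n R]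
    rfl
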